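/- All graphs are finite and simple. A graph $G$ has a *locally complete 2-edge-colouring* if its edges can be coloured with two colours so that, for each vertex $v$ and each colour, the vertices joined to $v$ by edges of that colour induce a complete subgraph of $G$. A graph is *reduced* if no two distinct vertices have the same closed neighbourhood. A *proper interval graph* is the intersection graph of a family of intervals of the real line none of which is properly contained in another. A *straight ordering* of $G$ is a linear ordering $v_1,\dots,v_n$ of its vertices in which every closed neighbourhood $N[v_i]$ consists of consecutive vertices; $\ell(v_i)$ and $\gamma(v_i)$ denote the first and the last vertex of $N[v_i]$, and $G[i,j]$ is the subgraph induced by $v_i,\dots,v_j$. The *clique covering number* $cc(G)$ is the least number of cliques that together contain all vertices. **Types.** Let $H$ be a 2-connected graph with straight ordering $v_1,\dots,v_m$ and $k=cc(H)\ge 2$. Its *canonical clique covering* consists of the maximal cliques $H[s_i,t_i]$ ($1\le i\le k$), where $t_i$ is the largest integer with $cc(H[1,t_i])=i$. Suppose that for each $i$ with $2\le i\le k-1$ we have $a<b$, where $v_a=\gamma(v_{s_i-1})$ and $v_b=\ell(v_{t_i+1})$ (computed in $H$). Then $H$ is of - *type 1* if $t_1=s_2$, $t_{k-1}=s_k$,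 and $t_i=s_{i+1}-1$ for all $2\le i\le k-2$; - *type 2* if $k\ge 3$, $t_1=s_2$, and $t_i=s_{i+1}-1$ for all $2\le i\le k-1$; - *type 3* if $k\ge 3$, $t_{k-1}=s_k$, and $t_i=s_{i+1}-1$ for all $1\le i\le k-2$; - *type 4* if $t_i=s_{i+1}-1$ for all $1\le i\le k-1$. (Here $H$ need not be reduced. An induced subgraph $G[i,j]$ carries the inherited ordering $v_i,\dots,v_j$.) **Theorem.** Let $G$ be a connected reduced proper interval graph with straight ordering $v_1,\dots,v_n$. Then $G$ has a locally complete 2-edge-colouring if and only if one of the following holds: 1. $G$ has no cutvertex, and either $cc(G)=1$ or $G$ is of one of the types 1, 2, 3, 4. 2. The cutvertices of $G$ are $v_{j_1},\dots,v_{j_c}$ with $c\ge 1$ and $1<j_1<j_2<\dots<j_c<n$, and - $cc(G[1,j_1])=1$, or $cc(G[1,j_1])=2$ and $G[1,j_1]$ is of type 1, or $G[1,j_1]$ is of type 2 or 4; - $cc(G[j_c,n])=1$, or $cc(G[j_c,n])=2$ and $G[j_c,n]$ is of type 1, or $G[j_c,n]$ is of type 3 or 4; and - for each $i=1,\dots,c-1$,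 either $cc(G[j_i,j_{i+1}])=1$ or $G[j_i,j_{i+1}]$ is of type 4. -/

import Mathlib

namespace LocComplete

/-- The closed neighbourhood `N[v]`. -/
def closedNbhd {V : Type*} (G : SimpleGraph V) (v : V) : Set V :=
  insert v (G.neighborSet v)

/-- `G` has a locally complete 2-edge-colouring: for some colouring of the edges with two colours,
the vertices joined to any vertex `v` by edges of any one colour `k` induce a complete subgraph. -/
def IsLocallyComplete2EdgeColourable {V : Type*} (G : SimpleGraph V) : Prop :=
  ∃ C : G.EdgeLabeling (Fin 2), ∀ (v : V) (k : Fin 2),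
    G.IsClique ((C.labelGraph k).neighborSet v)

/-- `G` has no true twins, i.e. no two distinct vertices with the same closed neighbourhood. -/
def IsReduced {V : Type*} (G : SimpleGraph V) : Prop :=
  ∀ u w : V, closedNbhd G u = closedNbhd G w → u = w

/-- `G` is the intersection graph of a family of intervals `[a v, b v]` of the real line, none of
which is properly contained in another. -/
def IsProperIntervalGraph {V : Type*} (G : SimpleGraph V) : Prop :=
  ∃ a b : V → ℝ, (∀ v, a v ≤ b v) ∧
    (∀ u w, ¬ Set.Icc (a u) (b u) ⊂ Set.Icc (a w) (b w)) ∧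
    (∀ u w, G.Adj u w ↔ u ≠ w ∧ (Set.Icc (a u) (b u) ∩ Set.Icc (a w) (b w)).Nonempty)

/-- The linear order on the vertices is a straight ordering of `G`: every closed neighbourhood
consists of consecutive vertices. -/
def IsStraightOrdering {V : Type*} [LinearOrder V] (G : SimpleGraph V) : Prop :=
  ∀ v : V, ∃ x y : V, closedNbhd G v = Set.Icc x y

/-- The clique covering number: the least number of cliques that together contain every vertex.
(The set below is nonempty when `V` is finite.) -/
noncomputable def cc {V : Type*} (G : SimpleGraph V) : ℕ :=
  sInf {k : ℕ | ∃ K : Finset (Set V),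
    K.card = k ∧ (∀ S ∈ K, G.IsClique S) ∧ ∀ v : V, ∃ S ∈ K, v ∈ S}

/-- `v` is a cutvertex: its deletion separates two vertices of the same component. -/
def IsCutvertex {V : Type*} (G : SimpleGraph V) (v : V) : Prop :=
  ∃ (u w : V) (hu : u ∈ ({v}ᶜ : Set V)) (hw : w ∈ ({v}ᶜ : Set V)),
    G.Reachable u w ∧ ¬ (G.induce {v}ᶜ).Reachable ⟨u, hu⟩ ⟨w, hw⟩

/-- `G` is 2-connected. -/
def IsTwoConnected {V : Type*} (G : SimpleGraph V) : Prop :=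
  3 ≤ Nat.card V ∧ G.Connected ∧ ∀ v : V, ¬ IsCutvertex G v

/-- `G[s i, t i]`, for `1 ≤ i ≤ cc G`, are the cliques of the canonical clique covering of `G` with
respect to the given linear order: they are maximal cliques, and `t i` is the last vertex such that
the subgraph induced by all vertices up to `t i` has clique covering number `i`.
The values of `s` and `t` at other indices are irrelevant. -/
def IsCanonicalCliqueCovering {V : Type*} [LinearOrder V] (G : SimpleGraph V) (s t : ℕ → V) :
    Prop :=
  ∀ i : ℕ, 1 ≤ i → i ≤ cc G →
    s i ≤ t i ∧ Maximal G.IsClique (Set.Icc (s i) (t i)) ∧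
    IsGreatest {x : V | cc (G.induce (Set.Iic x)) = i} (t i)

/-- The part common to all four types. For the second part: if `x` is the vertex just before `s i`
and `y` is the vertex just after `t i`, then the last vertex `a` of `N[x]` comes before the first
vertex `b` of `N[y]`. -/
def IsTyped {V : Type*} [LinearOrder V] (G : SimpleGraph V) (s t : ℕ → V) : Prop :=
  IsTwoConnected G ∧ IsStraightOrdering G ∧ 2 ≤ cc G ∧ IsCanonicalCliqueCovering G s t ∧
    ∀ i : ℕ, 2 ≤ i → i + 1 ≤ cc G → ∀ x y a b : V, x ⋖ s i → t i ⋖ y →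
      IsGreatest (closedNbhd G x) a → IsLeast (closedNbhd G y) b → a < b

/-- Type 1. Here and below `t i ⋖ s (i + 1)` says that `t i` is the vertex just before
`s (i + 1)`. -/
def IsType1 {V : Type*} [LinearOrder V] (G : SimpleGraph V) : Prop :=
  ∃ s t : ℕ → V, IsTyped G s t ∧ t 1 = s 2 ∧ t (cc G - 1) = s (cc G) ∧
    ∀ i : ℕ, 2 ≤ i → i + 2 ≤ cc G → t i ⋖ s (i + 1)

/-- Type 2. -/
def IsType2 {V : Type*} [LinearOrder V] (G : SimpleGraph V) : Prop :=
  ∃ s t : ℕ → V, IsTyped G s t ∧ 3 ≤ cc G ∧ t 1 = s 2 ∧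
    ∀ i : ℕ, 2 ≤ i → i + 1 ≤ cc G → t i ⋖ s (i + 1)

/-- Type 3. -/
def IsType3 {V : Type*} [LinearOrder V] (G : SimpleGraph V) : Prop :=
  ∃ s t : ℕ → V, IsTyped G s t ∧ 3 ≤ cc G ∧ t (cc G - 1) = s (cc G) ∧
    ∀ i : ℕ, 1 ≤ i → i + 2 ≤ cc G → t i ⋖ s (i + 1)

/-- Type 4. -/
def IsType4 {V : Type*} [LinearOrder V] (G : SimpleGraph V) : Prop :=
  ∃ s t : ℕ → V, IsTyped G s t ∧ ∀ i : ℕ, 1 ≤ i → i + 1 ≤ cc G → t i ⋖ s (i + 1)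

end LocComplete

/-!
Call two edges in conflict if they meet in a vertex and do not lie in a common triangle. A colouring
of the edges is locally complete exactly if edges in conflict have different colours. In a straight
ordering the conflicts are the pairs `xv`, `vy` with `x < v < y` and `x`, `y` not adjacent. At a
vertex `v`, the edges that are in conflict with another edge at `v` form a connected bipartite graph
of conflicts, so their colours are described by a single bit `A v`, the colour of those of them that
go to the left. An edge `uw` with `u < w` that is in conflict both at `u` and at `w` forces
`A u ≠ A w`, and there are no other restrictions. Hence the edges of `G` can be coloured if and only
if the vertices can be coloured so that the two middle vertices of each induced path on four
vertices differ (`isLocallyComplete2EdgeColourable_iff`, `IsMiddleColouring`).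

An edge never jumps over a cutvertex, so such vertex colourings can be restricted to the blocks and,
after interchanging the classes, glued at the cutvertices
(`IsUmbrella.exists_isMiddleColouringOn_union`). For a block the only trace of the rest of the graph
is whether its first and its last vertex is a cutvertex; this is recorded in the flags `PL`, `PR`.

It remains to treat one block (`exists_isMiddleColouring_iff_hasType`). The canonical clique
covering is the greedy one: each clique ends at the last neighbour of the first vertex not yet
covered (`IsGreedyCover`). If the block has one of the types, the cliques give a partition of the
order into complete parts such that no vertex has neighbours both in earlier and in later parts, and
the vertices with a neighbour in an earlier part, together with the first vertex if it is a
cutvertex of the whole graph, form a colour class (`IsGreedyCover.exists_isMiddleColouring`).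
Conversely, given a colouring, short odd cycles of pairs that must differ show that no vertex of an
inner clique has neighbours on both sides of the clique
(`IsGreedyCover.right_lt_left`). Two vertices shared by consecutive cliques would then be twins, so
consecutive cliques share at most one vertex (`IsGreedyCover.covBy_or_eq`), and a cycle of length
five shows that they can share one only at an end of the block that is no cutvertex
(`IsGreedyCover.end_of_eq`). These are the four types.
-/

namespace LocComplete

/-! ### Straight orderings -/

/-- The umbrella property of a linear order on the vertices: an edge `xz` forms a triangle with
every vertex between its ends. On a finite vertex set this is the same as a straight ordering. -/
def IsUmbrella {V : Type*} [LinearOrder V] (G : SimpleGraph V) : Prop :=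
  ∀ ⦃x y z : V⦄, x < y → y < z → G.Adj x z → G.Adj x y ∧ G.Adj y z

/-- `L v` and `R v` are the first and the last vertex of the closed neighbourhood of `v`, which
consists of consecutive vertices. -/
def HasEnds {V : Type*} [LinearOrder V] (G : SimpleGraph V) (L R : V → V) : Prop :=
  ∀ v : V, closedNbhd G v = Set.Icc (L v) (R v)

theorem mem_closedNbhd {V : Type*} {G : SimpleGraph V} {v w : V} :
    w ∈ closedNbhd G v ↔ w = v ∨ G.Adj v w := Iff.rfl

theorem IsStraightOrdering.exists_hasEnds {V : Type*} [LinearOrder V] {G : SimpleGraph V}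
    (h : IsStraightOrdering G) : ∃ L R : V → V, HasEnds G L R := by
  choose L R h using h
  exact ⟨L, R, h⟩

namespace HasEnds

variable {V : Type*} [LinearOrder V] {G : SimpleGraph V} {L R : V → V} (h : HasEnds G L R)
include h

theorem eq_or_adj_iff {v w : V} : (w = v ∨ G.Adj v w) ↔ L v ≤ w ∧ w ≤ R v := by
  rw [← mem_closedNbhd, h v, Set.mem_Icc]

theorem left_le (v : V) : L v ≤ v := (h.eq_or_adj_iff.1 (Or.inl rfl)).1

theorem le_right (v : V) : v ≤ R v := (h.eq_or_adj_iff.1 (Or.inl rfl)).2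

theorem adj_iff {v w : V} (hvw : v < w) : G.Adj v w ↔ w ≤ R v := by
  have h1 := h.eq_or_adj_iff (v := v) (w := w)
  have h2 := h.left_le v
  constructor
  · intro hA
    exact (h1.1 (Or.inr hA)).2
  · intro hA
    exact (h1.2 ⟨h2.trans hvw.le, hA⟩).resolve_left hvw.ne'

theorem adj_iff' {v w : V} (hvw : v < w) : G.Adj v w ↔ L w ≤ v := by
  have h1 := h.eq_or_adj_iff (v := w) (w := v)
  have h2 := h.le_right w
  rw [G.adj_comm]
  constructor
  · intro hA
    exact (h1.1 (Or.inr hA)).1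
  · intro hA
    exact (h1.2 ⟨hA, hvw.le.trans h2⟩).resolve_left hvw.ne

theorem le_right_iff {v w : V} (hvw : v ≤ w) : w ≤ R v ↔ L w ≤ v := by
  rcases hvw.eq_or_lt with rfl | hlt
  · simp [h.left_le, h.le_right]
  · rw [← h.adj_iff hlt, h.adj_iff' hlt]

theorem right_mono {v w : V} (hvw : v ≤ w) : R v ≤ R w := by
  rcases le_total (R v) w with h1 | h1
  · exact h1.trans (h.le_right w)
  · have h2 := (h.le_right_iff (h.le_right v)).1 le_rfl
    exact (h.le_right_iff h1).2 (h2.trans hvw)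

theorem left_mono {v w : V} (hvw : v ≤ w) : L v ≤ L w := by
  rcases le_total v (L w) with h1 | h1
  · exact (h.left_le v).trans h1
  · have h2 := (h.le_right_iff (h.left_le w)).2 le_rfl
    exact (h.le_right_iff h1).1 (hvw.trans h2)

theorem isUmbrella : IsUmbrella G := by
  intro x y z hxy hyz hA
  rw [h.adj_iff hxy, h.adj_iff' hyz]
  exact ⟨hyz.le.trans ((h.adj_iff (hxy.trans hyz)).1 hA),
    ((h.adj_iff' (hxy.trans hyz)).1 hA).trans hxy.le⟩

theorem closedNbhd_eq {v w : V} (hL : L v = L w) (hR : R v = R w) :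
    closedNbhd G v = closedNbhd G w := by
  rw [h v, h w, hL, hR]

theorem isClique_Icc {a b : V} (hab : b ≤ R a) :
    G.IsClique (Set.Icc a b) := by
  intro u hu w hw huw
  rcases lt_or_gt_of_ne huw with hlt | hlt
  · exact (h.adj_iff hlt).2 ((hw.2.trans hab).trans (h.right_mono hu.1))
  · exact ((h.adj_iff hlt).2 ((hu.2.trans hab).trans (h.right_mono hw.1))).symm

end HasEnds

theorem IsStraightOrdering.isUmbrella {V : Type*} [LinearOrder V] {G : SimpleGraph V}
    (h : IsStraightOrdering G) : IsUmbrella G := by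
  obtain ⟨L, R, h⟩ := h.exists_hasEnds
  exact h.isUmbrella

theorem IsUmbrella.isStraightOrdering {V : Type*} [Finite V] [LinearOrder V] {G : SimpleGraph V}
    (h : IsUmbrella G) : IsStraightOrdering G := by
  intro v
  have hne : (closedNbhd G v).Nonempty := ⟨v, Or.inl rfl⟩
  obtain ⟨x, hx⟩ := (Set.toFinite (closedNbhd G v)).exists_minimal hne
  obtain ⟨y, hy⟩ := (Set.toFinite (closedNbhd G v)).exists_maximal hne
  refine ⟨x, y, Set.Subset.antisymm (fun w hw => ⟨?_, ?_⟩) ?_⟩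
  · by_contra hlt
    exact hlt (hx.2 hw (not_le.1 hlt).le)
  · by_contra hlt
    exact hlt (hy.2 hw (not_le.1 hlt).le)
  · rintro w ⟨hxw, hwy⟩
    rcases lt_trichotomy w v with hw | hw | hw
    · rcases hxw.eq_or_lt with rfl | hxw
      · exact hx.1
      · have := hx.1.resolve_left (hxw.trans hw).ne
        exact Or.inr (h hxw hw this.symm).2.symm
    · exact Or.inl hw
    · rcases hwy.eq_or_lt with rfl | hwy
      · exact hy.1
      · have := hy.1.resolve_left (hw.trans hwy).ne'
        exact Or.inr (h hw hwy this).1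

theorem IsUmbrella.induce {V : Type*} [LinearOrder V] {G : SimpleGraph V}
    (h : IsUmbrella G) (S : Set V) : IsUmbrella (G.induce S) :=
  fun _ _ _ hxy hyz hA => h hxy hyz hA

/-! ### Connectedness and cutvertices in a straight ordering -/

section Connected

variable {V : Type*} [LinearOrder V] {G : SimpleGraph V}

theorem IsUmbrella.adj_of_le (h : IsUmbrella G) {u x y w : V} (hux : u ≤ x) (hxy : x < y)
    (hyw : y ≤ w) (hA : G.Adj u w) : G.Adj x y := by
  have hxw : G.Adj x w := by
    rcases hux.eq_or_lt with rfl | hlt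
    · exact hA
    · exact (h hlt (hxy.trans_le hyw) hA).2
  rcases hyw.eq_or_lt with rfl | hlt
  · exact hxw
  · exact (h hxy hlt hxw).1

/-- A path from below `x` to above `y` jumps over the gap between the consecutive vertices `x` and
`y`, so by the umbrella property these are adjacent. -/
theorem IsUmbrella.adj_of_covBy_of_reachable (h : IsUmbrella G) {x y u w : V} (hxy : x ⋖ y)
    (hu : u ≤ x) (hw : y ≤ w) (hr : G.Reachable u w) : G.Adj x y := by
  obtain ⟨p⟩ := hr
  obtain ⟨d, -, h1, h2⟩ := p.exists_boundary_dart (Set.Iic x) hu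
    (fun hwx => (hxy.lt.trans_le hw).not_ge hwx)
  exact h.adj_of_le h1 hxy.lt (hxy.ge_of_gt (not_le.1 h2)) d.adj

theorem IsUmbrella.adj_of_covBy (h : IsUmbrella G) (hc : G.Connected) {x y : V} (hxy : x ⋖ y) :
    G.Adj x y :=
  h.adj_of_covBy_of_reachable hxy le_rfl le_rfl (hc.preconnected x y)

theorem preconnected_of_forall_covBy [Finite V] (h : ∀ x y : V, x ⋖ y → G.Adj x y) :
    G.Preconnected := by
  have key : ∀ x y : V, x ≤ y → G.Reachable x y := by
    intro x y
    induction y using WellFoundedLT.induction with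
    | ind y ih =>
      intro hxy
      rcases hxy.eq_or_lt with rfl | hlt
      · rfl
      · obtain ⟨z, hz, hzy⟩ := exists_le_covBy_of_lt hlt
        exact (ih z hzy.lt hz).trans (h z y hzy).reachable
  intro x y
  rcases le_total x y with hxy | hxy
  · exact key x y hxy
  · exact (key y x hxy).symm

theorem isCutvertex_iff [Finite V] (h : IsUmbrella G) (hc : G.Connected) {v : V} :
    IsCutvertex G v ↔ ∃ x y : V, x ⋖ v ∧ v ⋖ y ∧ ¬ G.Adj x y := by
  constructor
  · rintro ⟨u, w, hu, hw, -, hn⟩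
    by_contra! hall
    refine hn (preconnected_of_forall_covBy ?_ _ _)
    rintro ⟨x, hx⟩ ⟨y, hy⟩ hxy
    have hx : x ≠ v := hx
    have hy : y ≠ v := hy
    have hlt : x < y := hxy.lt
    have hbt : ∀ z, x < z → z < y → z = v := by
      intro z h1 h2
      by_contra hz
      exact hxy.2 (c := ⟨z, hz⟩) h1 h2
    change G.Adj x y
    by_cases hv : x < v ∧ v < y
    · refine hall x y ⟨hv.1, fun z h1 h2 => ?_⟩ ⟨hv.2, fun z h1 h2 => ?_⟩
      · exact h2.ne (hbt z h1 (h2.trans hv.2))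
      · exact h1.ne' (hbt z (hv.1.trans h1) h2)
    · refine h.adj_of_covBy hc ⟨hlt, fun z h1 h2 => hv ?_⟩
      rw [← hbt z h1 h2]
      exact ⟨h1, h2⟩
  · rintro ⟨x, y, hx, hy, hn⟩
    refine ⟨x, y, hx.lt.ne, hy.lt.ne', hc.preconnected x y, fun hr => hn ?_⟩
    exact (h.induce {v}ᶜ).adj_of_covBy_of_reachable (x := ⟨x, hx.lt.ne⟩) (y := ⟨y, hy.lt.ne'⟩)
      ⟨hx.lt.trans hy.lt, fun z h1 h2 => by
        rcases lt_trichotomy z.1 v with hz | hz | hz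
        · exact hx.2 h1 hz
        · exact z.2 hz
        · exact hy.2 hz h2⟩ le_rfl le_rfl hr

end Connected

/-! ### Reduction to a colouring of the vertices -/

/-- A colouring `A` of the vertices that separates the ends of certain edges, where `PL` and `PR`
say that the first and the last vertex is to be treated as a cutvertex of a larger graph. For
`PL = PR = False` the edges are those in the middle of an induced path on four vertices. The flags
act as if a further vertex, adjacent only to the first vertex, were put in front of it, and
likewise behind the last vertex. -/
def IsMiddleColouring {V : Type*} [LinearOrder V] (G : SimpleGraph V) (PL PR : Prop)
    (A : V → Prop) : Prop :=
  ∀ u w : V, u < w → G.Adj u w →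
    (PL ∧ IsMin u ∨ ∃ x < u, G.Adj x u ∧ ¬ G.Adj x w) →
    (PR ∧ IsMax w ∨ ∃ y > w, G.Adj w y ∧ ¬ G.Adj u y) → (A u ↔ ¬ A w)

section Colouring

variable {V : Type*} [LinearOrder V] {G : SimpleGraph V}

open Classical in
/-- An edge `uw` with `u < w` is coloured according to `A w` if `w` has a later neighbour that is
not adjacent to `u`, and otherwise according to `¬ A u`. -/
theorem IsMiddleColouring.isLocallyComplete2EdgeColourable (h : IsUmbrella G) {A : V → Prop}
    (hA : IsMiddleColouring G False False A) : IsLocallyComplete2EdgeColourable G := by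
  let q : V → V → Prop := fun u w => if ∃ y > w, G.Adj w y ∧ ¬ G.Adj u y then A w else ¬ A u
  let f : V → V → Fin 2 := fun u w => if q (min u w) (max u w) then 0 else 1
  let C : G.EdgeLabeling (Fin 2) := SimpleGraph.EdgeLabeling.mk (fun u w _ => f u w)
    (fun u w _ => by simp only [f, min_comm, max_comm])
  have hf : ∀ u w k, ((C.labelGraph k).Adj u w ↔ G.Adj u w ∧ f u w = k) := by
    intro u w k
    rw [SimpleGraph.EdgeLabeling.labelGraph_adj]
    exact ⟨fun ⟨H, e⟩ => ⟨H, e⟩, fun ⟨H, e⟩ => ⟨H, e⟩⟩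
  -- the two edges of an induced path `x`, `v`, `y` get different colours
  have key : ∀ x v y, x < v → v < y → G.Adj x v → G.Adj v y → ¬ G.Adj x y → f x v ≠ f v y := by
    intro x v y hxv hvy h1 h2 h3
    have hq1 : q x v ↔ A v := by
      simp only [q]
      rw [if_pos ⟨y, hvy, h2, h3⟩]
    have hq2 : q v y ↔ ¬ A v := by
      simp only [q]
      split_ifs with hc
      · have := hA v y hvy h2 (Or.inr ⟨x, hxv, h1, h3⟩) (Or.inr hc)
        tauto
      · rfl
    simp only [f, min_eq_left hxv.le, max_eq_right hxv.le, min_eq_left hvy.le,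
      max_eq_right hvy.le]
    by_cases ha : A v
    · simp [hq1, hq2, ha]
    · simp [hq1, hq2, ha]
  have hsymm : ∀ u w, f u w = f w u := fun u w => by simp only [f, min_comm, max_comm]
  have key2 : ∀ v a b, a < b → G.Adj v a → G.Adj v b → f v a = f v b → G.Adj a b := by
    intro v a b hab ha hb hab'
    rcases lt_trichotomy v a with h1 | h1 | h1
    · exact (h h1 hab hb).2
    · exact absurd (h1 ▸ ha) (G.loopless.irrefl _)
    · rcases lt_trichotomy v b with h2 | h2 | h2
      · by_contra hn
        exact key a v b h1 h2 ha.symm hb hn (by rw [hsymm a v, hab'])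
      · exact absurd (h2 ▸ hb) (G.loopless.irrefl _)
      · exact (h hab h2 ha.symm).1
  refine ⟨C, fun v k => ?_⟩
  intro a ha b hb hab
  rw [SimpleGraph.mem_neighborSet, hf] at ha hb
  rcases lt_or_gt_of_ne hab with hlt | hlt
  · exact key2 v a b hlt ha.1 hb.1 (ha.2.trans hb.2.symm)
  · exact (key2 v b a hlt hb.1 ha.1 (hb.2.trans ha.2.symm)).symm

/-- Two edges that meet in `v` and do not lie in a triangle have different colours, so all edges
from `v` to earlier vertices `x`, with `x` not adjacent to some later neighbour of `v`, have the
same colour, which becomes the colour of `v`. -/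
theorem IsLocallyComplete2EdgeColourable.exists_isMiddleColouring (h : IsUmbrella G)
    (hG : IsLocallyComplete2EdgeColourable G) : ∃ A, IsMiddleColouring G False False A := by
  obtain ⟨C, hC⟩ := hG
  have hne : ∀ x v y (h1 : G.Adj x v) (h2 : G.Adj v y), x < v → v < y → ¬ G.Adj x y →
      C.get x v h1 ≠ C.get v y h2 := by
    intro x v y h1 h2 hxv hvy h3 he
    refine h3 (hC v (C.get v y h2) ?_ ?_ (hxv.trans hvy).ne)
    · rw [SimpleGraph.mem_neighborSet, SimpleGraph.EdgeLabeling.labelGraph_adj]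
      refine ⟨h1.symm, ?_⟩
      rw [← he]
      exact C.get_comm x v h1.symm
    · rw [SimpleGraph.mem_neighborSet, SimpleGraph.EdgeLabeling.labelGraph_adj]
      exact ⟨h2, rfl⟩
  have hfin : ∀ a b c : Fin 2, a ≠ c → b ≠ c → a = b := by decide
  let A : V → Prop := fun v => ∃ x, ∃ hx : G.Adj x v, x < v ∧ C.get x v hx = 0 ∧
    ∃ y > v, G.Adj v y ∧ ¬ G.Adj x y
  have key : ∀ x v y (h1 : G.Adj x v), G.Adj v y → x < v → v < y → ¬ G.Adj x y →
      (A v ↔ C.get x v h1 = 0) := by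
    intro x v y h1 h2 hxv hvy h3
    constructor
    · rintro ⟨x', h1', hx', h0, y', hvy', h2', h3'⟩
      rw [← h0]
      rcases le_total y y' with hyy | hyy
      · have h4 : ¬ G.Adj x y' := fun hA => h3 (h.adj_of_le le_rfl (hxv.trans hvy) hyy hA)
        exact hfin _ _ _ (hne x v y' h1 h2' hxv hvy' h4) (hne x' v y' h1' h2' hx' hvy' h3')
      · have h4 : ¬ G.Adj x' y := fun hA => h3' (h.adj_of_le le_rfl (hx'.trans hvy') hyy hA)
        exact hfin _ _ _ (hne x v y h1 h2 hxv hvy h3) (hne x' v y h1' h2 hx' hvy h4)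
    · intro h0
      exact ⟨x, h1, hxv, h0, y, hvy, h2, h3⟩
  refine ⟨A, fun u w huw hadj hx hy => ?_⟩
  obtain ⟨x, hxu, h1, h2⟩ := hx.resolve_left (fun h => h.1)
  obtain ⟨y, hwy, h3, h4⟩ := hy.resolve_left (fun h => h.1)
  rw [key x u w h1 hadj hxu huw h2, key u w y hadj h3 huw hwy h4]
  have := hne x u w h1 hadj hxu huw h2
  generalize C.get x u h1 = a at this
  generalize C.get u w hadj = b at this
  revert a b
  decide

theorem isLocallyComplete2EdgeColourable_iff (h : IsUmbrella G) :
    IsLocallyComplete2EdgeColourable G ↔ ∃ A, IsMiddleColouring G False False A :=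
  ⟨fun hG => hG.exists_isMiddleColouring h,
    fun ⟨_, hA⟩ => hA.isLocallyComplete2EdgeColourable h⟩

end Colouring

/-! ### Clique covering numbers of initial segments -/

section CliqueCover

variable {V : Type*} [Finite V] {G : SimpleGraph V}

theorem cc_le_iff {k : ℕ} :
    cc G ≤ k ↔ ∃ K : Finset (Set V), K.card ≤ k ∧ (∀ T ∈ K, G.IsClique T) ∧
      ∀ v, ∃ T ∈ K, v ∈ T := by
  classical
  constructor
  · intro hk
    have hne : {k : ℕ | ∃ K : Finset (Set V), K.card = k ∧ (∀ S ∈ K, G.IsClique S) ∧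
        ∀ v : V, ∃ S ∈ K, v ∈ S}.Nonempty := by
      have := Fintype.ofFinite V
      let K : Finset (Set V) := Finset.univ.image fun v : V => {v}
      refine ⟨K.card, K, rfl, ?_, ?_⟩
      · intro S hS
        obtain ⟨v, -, rfl⟩ := Finset.mem_image.1 hS
        exact G.isClique_singleton v
      · intro v
        exact ⟨{v}, Finset.mem_image_of_mem _ (Finset.mem_univ v), Set.mem_singleton v⟩
    obtain ⟨K, h1, h2, h3⟩ := Nat.sInf_mem hne
    exact ⟨K, h1.le.trans hk, h2, h3⟩
  · rintro ⟨K, h1, h2, h3⟩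
    have h4 : cc G ≤ K.card := Nat.sInf_le ⟨K, rfl, h2, h3⟩
    exact h4.trans h1

theorem cc_induce_le_iff {S : Set V} {k : ℕ} :
    cc (G.induce S) ≤ k ↔ ∃ K : Finset (Set V), K.card ≤ k ∧ (∀ T ∈ K, G.IsClique T) ∧
      ∀ v ∈ S, ∃ T ∈ K, v ∈ T := by
  classical
  rw [cc_le_iff]
  constructor
  · rintro ⟨K, h1, h2, h3⟩
    refine ⟨K.image (fun T => Subtype.val '' T), Finset.card_image_le.trans h1, ?_, ?_⟩
    · intro T hT
      obtain ⟨T', hT', rfl⟩ := Finset.mem_image.1 hT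
      rintro _ ⟨a, ha, rfl⟩ _ ⟨b, hb, rfl⟩ hab
      exact h2 T' hT' ha hb (fun h => hab (congrArg _ h))
    · intro v hv
      obtain ⟨T, hT, hvT⟩ := h3 ⟨v, hv⟩
      exact ⟨_, Finset.mem_image_of_mem _ hT, ⟨v, hv⟩, hvT, rfl⟩
  · rintro ⟨K, h1, h2, h3⟩
    refine ⟨K.image (fun T => Subtype.val ⁻¹' T), Finset.card_image_le.trans h1, ?_, ?_⟩
    · intro T hT
      obtain ⟨T', hT', rfl⟩ := Finset.mem_image.1 hT
      rintro a ha b hb hab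
      exact h2 T' hT' ha hb (fun h => hab (Subtype.ext h))
    · rintro ⟨v, hv⟩
      obtain ⟨T, hT, hvT⟩ := h3 v hv
      exact ⟨_, Finset.mem_image_of_mem _ hT, hvT⟩

theorem cc_induce_mono {S T : Set V} (h : S ⊆ T) : cc (G.induce S) ≤ cc (G.induce T) := by
  obtain ⟨K, h1, h2, h3⟩ := cc_induce_le_iff.1 (le_refl (cc (G.induce T)))
  exact cc_induce_le_iff.2 ⟨K, h1, h2, fun v hv => h3 v (h hv)⟩

theorem cc_induce_univ : cc (G.induce (Set.univ : Set V)) = cc G := by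
  refine eq_of_forall_ge_iff fun k => ?_
  rw [cc_induce_le_iff, cc_le_iff]
  simp

theorem cc_induce_pos {S : Set V} (h : S.Nonempty) : 1 ≤ cc (G.induce S) := by
  by_contra h0
  obtain ⟨K, h1, -, h3⟩ := cc_induce_le_iff.1 (show cc (G.induce S) ≤ 0 by omega)
  obtain ⟨v, hv⟩ := h
  obtain ⟨T, hT, -⟩ := h3 v hv
  rw [Nat.le_zero, Finset.card_eq_zero] at h1
  simp [h1] at hT

theorem cc_pos [Nonempty V] : 1 ≤ cc G := by
  rw [← cc_induce_univ]
  exact cc_induce_pos Set.univ_nonempty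

theorem adj_of_cc_eq_one (h : cc G = 1) {u w : V} (hne : u ≠ w) : G.Adj u w := by
  obtain ⟨K, h1, h2, h3⟩ := cc_le_iff.1 h.le
  obtain ⟨T, hT, hu⟩ := h3 u
  obtain ⟨T', hT', hw⟩ := h3 w
  rw [Finset.card_le_one.1 h1 T' hT' T hT] at hw
  exact h2 T hT hu hw hne

theorem three_le_card_of_two_le_cc (hc : G.Connected) (h : 2 ≤ cc G) : 3 ≤ Nat.card V := by
  classical
  by_contra hlt
  have hone : cc G ≤ 1 := by
    refine cc_le_iff.2 ⟨{Set.univ}, by simp, ?_, fun v => ⟨Set.univ, by simp, trivial⟩⟩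
    intro T hT u _ w _ huw
    obtain ⟨p⟩ := hc.preconnected u w
    have hx : ∀ x, x = u ∨ x = w := by
      intro x
      by_contra! hx
      have := Fintype.ofFinite V
      have h3 : ({x, u, w} : Finset V).card ≤ Fintype.card V := Finset.card_le_univ _
      rw [Finset.card_eq_three.2 ⟨x, u, w, hx.1, hx.2, huw, rfl⟩, ← Nat.card_eq_fintype_card] at h3
      omega
    obtain ⟨d, -, h1, h2⟩ := p.exists_boundary_dart {u} rfl (fun h => huw h.symm)
    have h1 : d.fst = u := h1
    have h2 : d.snd = w := (hx d.snd).resolve_left h2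
    rw [← h1, ← h2]
    exact d.adj
  omega

variable [LinearOrder V] {L R : V → V}

/-- The clique between `y` and `x` covers what is missing. -/
theorem HasEnds.cc_Iic_le_succ (h : HasEnds G L R) {t y x : V} (hty : t ⋖ y) (hx : x ≤ R y) :
    cc (G.induce (Set.Iic x)) ≤ cc (G.induce (Set.Iic t)) + 1 := by
  classical
  obtain ⟨K, h1, h2, h3⟩ := cc_induce_le_iff.1 (le_refl (cc (G.induce (Set.Iic t))))
  have key : ∀ a b, y ≤ a → a < b → b ≤ x → G.Adj a b := by
    intro a b ha hab hb
    exact (h.adj_iff hab).2 ((hb.trans hx).trans (h.right_mono ha))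
  refine cc_induce_le_iff.2 ⟨insert (Set.Icc y x) K, (Finset.card_insert_le _ _).trans
    (by omega), ?_, ?_⟩
  · intro T hT
    rcases Finset.mem_insert.1 hT with rfl | hT
    · intro a ha b hb hab
      rcases lt_or_gt_of_ne hab with hlt | hlt
      · exact key a b ha.1 hlt hb.2
      · exact (key b a hb.1 hlt ha.2).symm
    · exact h2 T hT
  · intro v hv
    rcases le_or_gt v t with hvt | hvt
    · obtain ⟨T, hT, hvT⟩ := h3 v hvt
      exact ⟨T, Finset.mem_insert_of_mem hT, hvT⟩
    · exact ⟨_, Finset.mem_insert_self _ _, hty.ge_of_gt hvt, hv⟩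

/-- The clique of a covering that contains `z` contains no vertex up to `y`. -/
theorem IsUmbrella.succ_cc_Iic_le (h : IsUmbrella G) {y z : V} (hyz : y < z)
    (hn : ¬ G.Adj y z) : cc (G.induce (Set.Iic y)) + 1 ≤ cc (G.induce (Set.Iic z)) := by
  classical
  obtain ⟨K, h1, h2, h3⟩ := cc_induce_le_iff.1 (le_refl (cc (G.induce (Set.Iic z))))
  obtain ⟨T, hT, hzT⟩ := h3 z (Set.mem_Iic.2 le_rfl)
  have hpos := Finset.card_pos.2 ⟨T, hT⟩
  have hle : cc (G.induce (Set.Iic y)) ≤ (K.erase T).card := by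
    refine cc_induce_le_iff.2 ⟨K.erase T, le_rfl, fun T' hT' => h2 T' (Finset.mem_of_mem_erase hT'),
      fun v hv => ?_⟩
    have hv : v ≤ y := hv
    obtain ⟨T', hT', hvT'⟩ := h3 v (hv.trans hyz.le)
    refine ⟨T', Finset.mem_erase.2 ⟨?_, hT'⟩, hvT'⟩
    rintro rfl
    have hA := h2 T' hT hvT' hzT (hv.trans_lt hyz).ne
    rcases hv.eq_or_lt with rfl | hlt
    · exact hn hA
    · exact hn (h hlt hyz hA).2
  rw [Finset.card_erase_of_mem hT] at hle
  omega

theorem HasEnds.cc_Iic_of_isMin (h : HasEnds G L R) {b x : V} (hb : IsMin b) (hx : x ≤ R b) :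
    cc (G.induce (Set.Iic x)) = 1 := by
  classical
  refine le_antisymm ?_ (cc_induce_pos ⟨x, Set.mem_Iic.2 le_rfl⟩)
  have hb' : ∀ v, b ≤ v := fun v => (le_total b v).elim id fun h => hb h
  have key : ∀ a c, a < c → c ≤ x → G.Adj a c := fun a c hac hc =>
    (h.adj_iff hac).2 ((hc.trans hx).trans (h.right_mono (hb' a)))
  refine cc_induce_le_iff.2 ⟨{Set.Iic x}, by simp, ?_, fun v hv => ⟨_, by simp, hv⟩⟩
  intro T hT
  rw [Finset.mem_singleton] at hT
  subst hT
  intro a ha c hc hac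
  rcases lt_or_gt_of_ne hac with hlt | hlt
  · exact key a c hlt hc
  · exact (key c a hlt ha).symm

theorem cc_Iic_of_isMax {m : V} (hm : IsMax m) : cc (G.induce (Set.Iic m)) = cc G := by
  have : Set.Iic m = Set.univ :=
    Set.eq_univ_of_forall fun v => (le_total v m).elim id fun h => hm h
  rw [this, cc_induce_univ]

/-! ### The canonical clique covering -/

/-- The canonical clique covering in terms of the ends `L v`, `R v` of the neighbourhoods: each
clique ends at `R p`, where `p` is the vertex after the preceding clique. -/
structure IsGreedyCover {V : Type*} [LinearOrder V] (L R : V → V) (k : ℕ) (s t : ℕ → V) : Prop where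
  left : ∀ i, 1 ≤ i → i ≤ k → L (t i) = s i
  right : ∀ i, 1 ≤ i → i ≤ k → R (s i) = t i
  isMin : IsMin (s 1)
  isMax : IsMax (t k)
  lt : ∀ i, 1 ≤ i → i < k → t i < t (i + 1)
  right_of_covBy : ∀ i, 1 ≤ i → i < k → ∀ p, t i ⋖ p → R p = t (i + 1)

theorem lt_of_isGreatest_cc {t : ℕ → V}
    (ht : ∀ i, 1 ≤ i → i ≤ cc G →
      IsGreatest {x : V | cc (G.induce (Set.Iic x)) = i} (t i))
    (i : ℕ) (hi : 1 ≤ i) (hi' : i < cc G) : t i < t (i + 1) := by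
  by_contra hle
  have h1 := cc_induce_mono (G := G) (Set.Iic_subset_Iic.2 (not_lt.1 hle))
  have h2 : cc (G.induce (Set.Iic (t i))) = i := (ht i hi hi'.le).1
  have h3 : cc (G.induce (Set.Iic (t (i + 1)))) = i + 1 := (ht (i + 1) (by omega) hi').1
  omega

theorem HasEnds.right_of_covBy_of_isGreatest_cc (h : HasEnds G L R) {t : ℕ → V}
    (ht : ∀ i, 1 ≤ i → i ≤ cc G →
      IsGreatest {x : V | cc (G.induce (Set.Iic x)) = i} (t i))
    (i : ℕ) (hi : 1 ≤ i) (hi' : i < cc G) (p : V) (hp : t i ⋖ p) : R p = t (i + 1) := by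
  have h2 : cc (G.induce (Set.Iic (t i))) = i := (ht i hi hi'.le).1
  have h3 : cc (G.induce (Set.Iic (t (i + 1)))) = i + 1 := (ht (i + 1) (by omega) hi').1
  have h4 := cc_induce_mono (G := G) (Set.Iic_subset_Iic.2 hp.le)
  have h5 : cc (G.induce (Set.Iic p)) ≠ i := fun he => hp.lt.not_ge ((ht i hi hi'.le).2 he)
  have h6 := cc_induce_mono (G := G) (Set.Iic_subset_Iic.2 (h.le_right p))
  have h7 := h.cc_Iic_le_succ hp (le_refl (R p))
  refine le_antisymm ((ht (i + 1) (by omega) hi').2 (show _ = _ by omega)) ?_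
  have hpt := hp.ge_of_gt (lt_of_isGreatest_cc ht i hi hi')
  rcases hpt.eq_or_lt with he | hlt
  · rw [← he]
    exact h.le_right p
  · rw [← h.adj_iff hlt]
    by_contra hn
    have := h.isUmbrella.succ_cc_Iic_le hlt hn
    omega

theorem HasEnds.right_of_isMin_of_isGreatest_cc (h : HasEnds G L R) {t b : V}
    (ht : IsGreatest {x : V | cc (G.induce (Set.Iic x)) = 1} t) (hb : IsMin b) : R b = t := by
  refine le_antisymm (ht.2 (h.cc_Iic_of_isMin hb le_rfl)) ?_
  have hbt : b ≤ t := (le_total b t).elim id fun h => hb h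
  rcases hbt.eq_or_lt with he | hlt
  · rw [← he]
    exact h.le_right b
  · rw [← h.adj_iff hlt]
    by_contra hn
    have h1 := h.isUmbrella.succ_cc_Iic_le hlt hn
    have h2 : cc (G.induce (Set.Iic t)) = 1 := ht.1
    have h3 := cc_induce_pos (G := G) (S := Set.Iic b) ⟨b, Set.mem_Iic.2 le_rfl⟩
    omega

theorem HasEnds.isGreedyCover (h : HasEnds G L R) [Nonempty V] {s t : ℕ → V}
    (hst : IsCanonicalCliqueCovering G s t) : IsGreedyCover L R (cc G) s t := by
  have ht : ∀ i, 1 ≤ i → i ≤ cc G →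
      IsGreatest {x : V | cc (G.induce (Set.Iic x)) = i} (t i) :=
    fun i hi hi' => (hst i hi hi').2.2
  have hle : ∀ i, 1 ≤ i → i ≤ cc G → t i ≤ R (s i) := by
    intro i hi hi'
    obtain ⟨h1, h2, -⟩ := hst i hi hi'
    rcases h1.eq_or_lt with he | hlt
    · rw [← he]
      exact h.le_right _
    · exact (h.adj_iff hlt).1 (h2.1 ⟨le_rfl, h1⟩ ⟨h1, le_rfl⟩ hlt.ne)
  have hleft : ∀ i, 1 ≤ i → i ≤ cc G → L (t i) = s i := by
    intro i hi hi'
    obtain ⟨h1, h2, -⟩ := hst i hi hi'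
    have h3 := (h.le_right_iff h1).1 (hle i hi hi')
    have h4 := (h.le_right_iff (h.left_le (t i))).2 le_rfl
    exact le_antisymm h3 (h2.2 (h.isClique_Icc h4) (Set.Icc_subset_Icc_left h3)
      ⟨le_rfl, h.left_le _⟩).1
  have hright : ∀ i, 1 ≤ i → i ≤ cc G → R (s i) = t i := by
    intro i hi hi'
    obtain ⟨h1, h2, -⟩ := hst i hi hi'
    exact le_antisymm (h2.2 (h.isClique_Icc le_rfl) (Set.Icc_subset_Icc_right (hle i hi hi'))
      ⟨h.le_right _, le_rfl⟩).2 (hle i hi hi')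
  have hpos := cc_pos (G := G)
  obtain ⟨b, hb⟩ := Finite.exists_min (id : V → V)
  have hb' : IsMin b := fun v _ => hb v
  obtain ⟨m, hm⟩ := Finite.exists_max (id : V → V)
  refine ⟨hleft, hright, ?_, ?_, lt_of_isGreatest_cc ht, h.right_of_covBy_of_isGreatest_cc ht⟩
  · have h1 := h.right_of_isMin_of_isGreatest_cc (ht 1 le_rfl hpos) hb'
    have h2 : L (t 1) ≤ b := (h.le_right_iff (hb (t 1))).1 h1.ge
    rw [hleft 1 le_rfl hpos] at h2
    exact fun v _ => h2.trans (hb v)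
  · have h1 : m ≤ t (cc G) := (ht (cc G) hpos le_rfl).2 (cc_Iic_of_isMax fun v _ => hm v)
    exact fun v _ => (hm v).trans h1

theorem exists_cc_Iic_eq [Nonempty V] (h : HasEnds G L R) {i : ℕ} (hi : 1 ≤ i) (hi' : i ≤ cc G) :
    ∃ x, cc (G.induce (Set.Iic x)) = i := by
  obtain ⟨b, hb⟩ := Finite.exists_min (id : V → V)
  have hb' : cc (G.induce (Set.Iic b)) ≤ i :=
    (h.cc_Iic_of_isMin (fun v _ => hb v) (h.le_right b)).le.trans hi
  obtain ⟨x, hx⟩ := (Set.toFinite {x : V | cc (G.induce (Set.Iic x)) ≤ i}).exists_maximal ⟨b, hb'⟩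
  have hx1 : cc (G.induce (Set.Iic x)) ≤ i := hx.1
  refine ⟨x, le_antisymm hx1 ?_⟩
  by_cases hmax : IsMax x
  · rwa [cc_Iic_of_isMax hmax]
  · obtain ⟨z, hxz⟩ := not_isMax_iff.1 hmax
    obtain ⟨y, hy, -⟩ := exists_covBy_le_of_lt hxz
    have h1 := h.cc_Iic_le_succ hy (h.le_right y)
    have h2 : ¬ cc (G.induce (Set.Iic y)) ≤ i := fun hle => hy.lt.not_ge (hx.2 hle hy.le)
    omega

theorem HasEnds.exists_isCanonicalCliqueCovering [Nonempty V] (h : HasEnds G L R) :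
    ∃ s t : ℕ → V, IsCanonicalCliqueCovering G s t := by
  have ht : ∀ i : ℕ, ∃ x, 1 ≤ i → i ≤ cc G →
      IsGreatest {x : V | cc (G.induce (Set.Iic x)) = i} x := by
    intro i
    by_cases hi : 1 ≤ i ∧ i ≤ cc G
    · obtain ⟨x, hx⟩ := (Set.toFinite {x : V | cc (G.induce (Set.Iic x)) = i}).exists_maximal
        (exists_cc_Iic_eq h hi.1 hi.2)
      exact ⟨x, fun _ _ => ⟨hx.1, fun y hy => (le_total x y).elim (fun hxy => hx.2 hy hxy) id⟩⟩
    · exact ⟨Classical.arbitrary V, fun h1 h2 => absurd ⟨h1, h2⟩ hi⟩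
  choose t ht using ht
  refine ⟨fun i => L (t i), t, fun i hi hi' => ⟨h.left_le _, ⟨?_, ?_⟩, ht i hi hi'⟩⟩
  · exact h.isClique_Icc ((h.le_right_iff (h.left_le _)).2 le_rfl)
  · -- some vertex `p` of the clique has no neighbour behind `t i`
    obtain ⟨p, hp, hpR⟩ : ∃ p, L (t i) ≤ p ∧ R p = t i := by
      obtain rfl | ⟨j, hj, rfl⟩ : i = 1 ∨ ∃ j, 1 ≤ j ∧ i = j + 1 := by
        rcases i with _ | _ | j
        · omega
        · exact Or.inl rfl
        · exact Or.inr ⟨j + 1, by omega, rfl⟩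
      · obtain ⟨b, hb⟩ := Finite.exists_min (id : V → V)
        have h1 := h.right_of_isMin_of_isGreatest_cc (ht 1 hi hi') (fun v _ => hb v)
        exact ⟨b, (h.le_right_iff (hb (t 1))).1 h1.ge, h1⟩
      · have hlt := lt_of_isGreatest_cc ht j hj hi'
        obtain ⟨p, hp, hple⟩ := exists_covBy_le_of_lt hlt
        have h1 := h.right_of_covBy_of_isGreatest_cc ht j hj hi' p hp
        exact ⟨p, (h.le_right_iff hple).1 h1.ge, h1⟩
    intro T hT hsub x hx
    have hmemL : L (t i) ∈ T := hsub ⟨le_rfl, h.left_le _⟩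
    have hmemt : t i ∈ T := hsub ⟨h.left_le _, le_rfl⟩
    constructor
    · by_contra hlt
      have hlt := not_le.1 hlt
      have hxt := hlt.trans_le (h.left_le (t i))
      exact hlt.not_ge ((h.adj_iff' hxt).1 (hT hx hmemt hxt.ne))
    · by_contra hlt
      have hlt := not_le.1 hlt
      have hLx := (h.left_le (t i)).trans_lt hlt
      have h1 := (h.adj_iff hLx).1 (hT hmemL hx hLx.ne)
      have h2 := h.right_mono hp
      rw [hpR] at h2
      exact hlt.not_ge (h1.trans h2)

end CliqueCover

/-! ### The canonical covering of a block with a colouring -/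

section Block

variable {V : Type*} [LinearOrder V] {G : SimpleGraph V} {L R : V → V}

theorem IsMiddleColouring.iff_not {PL PR : Prop} {A : V → Prop}
    (hA : IsMiddleColouring G PL PR A) (h : HasEnds G L R) {u w : V} (huw : u < w) (hw : w ≤ R u)
    (hL : PL ∧ IsMin u ∨ L u < L w) (hR : PR ∧ IsMax w ∨ R u < R w) : A u ↔ ¬ A w := by
  refine hA u w huw ((h.adj_iff huw).2 hw) (hL.imp_right fun hlt => ?_)
    (hR.imp_right fun hlt => ?_)
  · have h1 : L w ≤ u := (h.le_right_iff huw.le).1 hw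
    have h2 : L u < u := hlt.trans_le h1
    refine ⟨L u, h2, (h.adj_iff' h2).2 le_rfl, fun hA => ?_⟩
    exact hlt.not_ge ((h.adj_iff' (h2.trans huw)).1 hA)
  · have h2 : w < R w := hw.trans_lt hlt
    refine ⟨R w, h2, (h.adj_iff h2).2 le_rfl, fun hA => ?_⟩
    exact hlt.not_ge ((h.adj_iff (huw.trans h2)).1 hA)

theorem HasEnds.le_right_of_covBy (h : HasEnds G L R) (hc : G.Connected) {x y : V} (hxy : x ⋖ y) :
    y ≤ R x :=
  (h.adj_iff hxy.lt).1 (h.isUmbrella.adj_of_covBy hc hxy)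

theorem HasEnds.left_le_of_covBy (h : HasEnds G L R) (hc : G.Connected) {x y : V} (hxy : x ⋖ y) :
    L y ≤ x :=
  (h.adj_iff' hxy.lt).1 (h.isUmbrella.adj_of_covBy hc hxy)

variable {k : ℕ} {s t : ℕ → V}

theorem IsGreedyCover.start_lt (c : IsGreedyCover L R k s t) (h : HasEnds G L R) {i : ℕ}
    (hi : 1 ≤ i) (hi' : i < k) : s i < s (i + 1) := by
  by_contra hle
  have h1 := h.right_mono (not_lt.1 hle)
  rw [c.right i hi hi'.le, c.right (i + 1) (by omega) hi'] at h1
  exact h1.not_gt (c.lt i hi hi')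

theorem IsGreedyCover.start_le (c : IsGreedyCover L R k s t) (h : HasEnds G L R) {i : ℕ}
    (hi : 1 ≤ i) (hi' : i ≤ k) : s i ≤ t i := by
  rw [← c.left i hi hi']
  exact h.left_le _

theorem IsGreedyCover.start_le_of_covBy (c : IsGreedyCover L R k s t) (h : HasEnds G L R) {i : ℕ}
    (hi : 1 ≤ i) (hi' : i < k) {p : V} (hp : t i ⋖ p) : s (i + 1) ≤ p := by
  rw [← c.left (i + 1) (by omega) hi']
  exact (h.le_right_iff (hp.ge_of_gt (c.lt i hi hi'))).1 (c.right_of_covBy i hi hi' p hp).ge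

variable [Finite V]

set_option maxHeartbeats 1600000 in
/-- In a block with a colouring, no vertex of an inner clique of the canonical covering has
neighbours both in front of and behind that clique. Such a vertex would give an odd cycle of
differently coloured pairs, unless the vertex `L (s i)` of the preceding clique has the same
defect. -/
theorem IsGreedyCover.right_lt_left (c : IsGreedyCover L R k s t) (h : HasEnds G L R)
    (hc : G.Connected) (hcut : ∀ x v y : V, x ⋖ v → v ⋖ y → G.Adj x y)
    (hred : ∀ u w : V, ¬ IsMin u → ¬ IsMax u → ¬ IsMin w → ¬ IsMax w → L u = L w → R u = R w →
      u = w)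
    {PL PR : Prop} {A : V → Prop} (hA : IsMiddleColouring G PL PR A) :
    ∀ i, 2 ≤ i → i < k → ∀ x y, x ⋖ s i → t i ⋖ y → R x < L y := by
  intro i
  induction i with
  | zero => omega
  | succ j ih =>
    intro hj hjk a b ha hb
    by_contra hba
    have hba := not_lt.1 hba
    have hj1 : 1 ≤ j := by omega
    have hLt := c.left (j + 1) (by omega) hjk.le
    have hRs := c.right (j + 1) (by omega) hjk.le
    have hLt' := c.left j hj1 (by omega)
    have hRs' := c.right j hj1 (by omega)
    have htt := c.lt j hj1 (by omega)
    have hst' := c.start_le h hj1 (by omega)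
    -- `p` is the first vertex that is not covered by the preceding cliques
    obtain ⟨p, hp, hpt⟩ := exists_covBy_le_of_lt htt
    have hRp := c.right_of_covBy j hj1 (by omega) p hp
    have hsp := c.start_le_of_covBy h hj1 (by omega) hp
    have hmin1 : j = 1 → IsMin (s j) := fun he => he ▸ c.isMin
    generalize t (j + 1) = t₂ at *
    generalize s (j + 1) = s₂ at *
    generalize t j = t₁ at *
    generalize s j = s₁ at *
    have hbt := h.le_right_of_covBy hc hb
    have hsa := h.left_le_of_covBy hc ha
    have hlt_a := ha.lt
    have hlt_b := hb.lt
    have hlt_p := hp.lt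
    have hsb : s₂ < L b := by
      by_contra hle
      have := (h.le_right_iff (show s₂ ≤ b by order)).2 (not_lt.1 hle)
      order
    -- `v` is the last neighbour of the vertex `a` before the clique
    obtain ⟨v, hv⟩ : ∃ v, R a = v := ⟨_, rfl⟩
    rw [hv] at hba
    have hvt : v < t₂ := by
      by_contra hle
      have := (h.le_right_iff (show a ≤ t₂ by order)).1 (hv ▸ not_lt.1 hle)
      order
    have hbv : b ≤ R v := (h.le_right_iff (show v ≤ b by order)).2 hba
    have hpv : p < v := by
      by_contra hle
      have := h.right_mono (not_lt.1 hle)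
      order
    have hva : L v ≤ a := (h.le_right_iff (show a ≤ v by order)).1 hv.ge
    have hLpv := h.left_mono hpv.le
    have hsLp : s₁ < L p := by
      by_contra hle
      have := (h.le_right_iff (show s₁ ≤ p by order)).2 (not_lt.1 hle)
      order
    have hat : a ≤ t₁ := hp.le_of_lt (by order)
    have hLa : L a ≤ s₁ := hLt' ▸ h.left_mono hat
    have hLpa : L p ≤ a := by order
    have e1 := hA.iff_not h (u := a) (w := p) (by order) (by order) (Or.inr (by order))
      (Or.inr (by order))
    have e2 := hA.iff_not h (u := a) (w := v) (by order) (by order) (Or.inr (by order))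
      (Or.inr (by order))
    -- otherwise `a`, `p`, `v` would have to be coloured in three different ways
    have hLeq : L p = L v := by
      by_contra hne
      have := hA.iff_not h (u := p) (w := v) (by order) (by order) (Or.inr (by order))
        (Or.inr (by order))
      tauto
    have e4 := hA.iff_not h (u := p) (w := t₂) (by order) (by order) (Or.inr (by order))
      (Or.inr (by order))
    -- otherwise `s₂`, `v`, `a`, `p`, `t₂` would form a cycle of length five
    obtain rfl : s₂ = p := by
      by_contra hne
      have hst : s₂ ≤ t₁ := hp.le_of_lt (by order)
      have hLs : L s₂ ≤ s₁ := hLt' ▸ h.left_mono hst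
      have e5 := hA.iff_not h (u := s₂) (w := v) (by order) (by order) (Or.inr (by order))
        (Or.inr (by order))
      have e6 := hA.iff_not h (u := s₂) (w := t₂) (by order) (by order) (Or.inr (by order))
        (Or.inr (by order))
      tauto
    obtain rfl : a = t₁ := le_antisymm hat (ha.le_of_lt hlt_p)
    obtain ⟨a', ha'⟩ : ∃ a', a' ⋖ a := by
      obtain ⟨a', -, ha'⟩ := exists_le_covBy_of_lt (show s₁ < a by order)
      exact ⟨a', ha'⟩
    have hlt_a' := ha'.lt
    -- since `a` is no cutvertex, `g` lies before `a`
    obtain ⟨g, hg⟩ : ∃ g, L s₂ = g := ⟨_, rfl⟩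
    have hga : g ≤ a' := by
      rw [← hg]
      exact (h.adj_iff' (by order)).1 (hcut a' a s₂ ha' ha)
    have hRg : R g = v := by
      refine le_antisymm (hv ▸ h.right_mono (show g ≤ a by order)) ?_
      exact (h.le_right_iff (by order)).2 (by order)
    -- `g` and `a` are no twins, so `g` has a neighbour before the clique from `s₁` to `a`
    have hLg : L g ≠ L a := by
      intro he
      have : g = a := hred g a (not_isMin_iff.2 ⟨s₁, by order⟩) (not_isMax_iff.2 ⟨a, by order⟩)
        (not_isMin_iff.2 ⟨g, by order⟩) (not_isMax_iff.2 ⟨s₂, by order⟩) he (by order)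
      order
    have hLg' : L g < s₁ := by
      have := h.left_mono (show g ≤ a by order)
      order
    obtain ⟨x, hx, hxs⟩ := exists_le_covBy_of_lt hLg'
    have hj2 : 2 ≤ j := by
      by_contra hlt
      exact (hmin1 (by omega)).not_lt hLg'
    have hlt := ih hj2 (by omega) x s₂ hxs hp
    have := (h.le_right_iff (show x ≤ g by have := hxs.lt; order)).2 hx
    order

theorem IsGreedyCover.left_eq_and_right_eq (c : IsGreedyCover L R k s t) (h : HasEnds G L R)
    (hT : ∀ i, 2 ≤ i → i < k → ∀ x y, x ⋖ s i → t i ⋖ y → R x < L y) {i : ℕ} (hi : 1 ≤ i)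
    (hi' : i < k) {v : V} (hsv : s (i + 1) ≤ v) (hvt : v ≤ t i) :
    L v = s i ∧ R v = t (i + 1) := by
  have hLt := c.left i hi hi'.le
  have hLt' := c.left (i + 1) (by omega) hi'
  have hRs' := c.right (i + 1) (by omega) hi'
  have hss := c.start_lt h hi hi'
  have htt := c.lt i hi hi'
  have h1 := h.left_mono hvt
  have h2 := h.right_mono hsv
  have hL : L v = s i := by
    by_contra hne
    have hlt : L v < s i := by order
    have hi2 : 2 ≤ i := by
      by_contra hlt2
      obtain rfl : i = 1 := by omega
      exact c.isMin.not_lt hlt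
    obtain ⟨x, hx, hxs⟩ := exists_le_covBy_of_lt hlt
    obtain ⟨y, hy, hyt⟩ := exists_covBy_le_of_lt htt
    have h3 := hT i hi2 hi' x y hxs hy
    have h4 := h.left_mono hyt
    have h5 := (h.le_right_iff (show x ≤ v by have := hxs.lt; order)).2 hx
    order
  refine ⟨hL, ?_⟩
  by_contra hne
  have hlt : t (i + 1) < R v := by order
  have hik : i + 1 < k := by
    by_contra hle
    obtain rfl : i + 1 = k := by omega
    exact c.isMax.not_lt hlt
  obtain ⟨x, hx, hxs⟩ := exists_le_covBy_of_lt hss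
  obtain ⟨y, hy, hyt⟩ := exists_covBy_le_of_lt hlt
  have h3 := hT (i + 1) (by omega) hik x y hxs hy
  have h4 := (h.le_right_iff (show v ≤ y by have := hy.lt; order)).1 hyt
  have h5 := (h.le_right_iff (show x ≤ v by have := hxs.lt; order)).2 (by order)
  order

theorem IsGreedyCover.covBy_or_eq (c : IsGreedyCover L R k s t) (h : HasEnds G L R)
    (hred : ∀ u w : V, ¬ IsMin u → ¬ IsMax u → ¬ IsMin w → ¬ IsMax w → L u = L w → R u = R w →
      u = w)
    (hT : ∀ i, 2 ≤ i → i < k → ∀ x y, x ⋖ s i → t i ⋖ y → R x < L y) {i : ℕ} (hi : 1 ≤ i)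
    (hi' : i < k) : t i ⋖ s (i + 1) ∨ t i = s (i + 1) := by
  have htt := c.lt i hi hi'
  have hss := c.start_lt h hi hi'
  obtain ⟨p, hp, -⟩ := exists_covBy_le_of_lt htt
  rcases (c.start_le_of_covBy h hi hi' hp).eq_or_lt with he | hlt
  · exact Or.inl (he ▸ hp)
  · have hle := hp.le_of_lt hlt
    obtain ⟨h1, h2⟩ := c.left_eq_and_right_eq h hT hi hi' le_rfl hle
    obtain ⟨h3, h4⟩ := c.left_eq_and_right_eq h hT hi hi' hle le_rfl
    exact Or.inr (hred _ _ (not_isMin_iff.2 ⟨s i, by order⟩) (not_isMax_iff.2 ⟨t (i + 1), by order⟩)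
      (not_isMin_iff.2 ⟨s i, by order⟩) (not_isMax_iff.2 ⟨t (i + 1), by order⟩)
      (by order) (by order))

set_option maxHeartbeats 1600000 in
/-- If two consecutive cliques of the canonical covering share a vertex `u`, then `s i`, `u`,
`t (i + 1)` and the neighbours of `u` in the order form a cycle of length five of differently
coloured pairs, unless one of the two cliques lies at an end of the block that is no cutvertex. -/
theorem IsGreedyCover.end_of_eq (c : IsGreedyCover L R k s t) (h : HasEnds G L R)
    (hc : G.Connected) (hcut : ∀ x v y : V, x ⋖ v → v ⋖ y → G.Adj x y)
    {PL PR : Prop} {A : V → Prop} (hA : IsMiddleColouring G PL PR A)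
    (hT : ∀ i, 2 ≤ i → i < k → ∀ x y, x ⋖ s i → t i ⋖ y → R x < L y) {i : ℕ} (hi : 1 ≤ i)
    (hi' : i < k) (he : t i = s (i + 1)) : (i = 1 ∧ ¬ PL) ∨ (i + 1 = k ∧ ¬ PR) := by
  by_contra hcon
  rw [not_or, not_and_not_right, not_and_not_right] at hcon
  have hPL : PL ∧ IsMin (s i) ∨ L (s i) < s i := by
    by_cases hmin : IsMin (s i)
    · refine Or.inl ⟨hcon.1 ?_, hmin⟩
      by_contra hne
      obtain ⟨j, rfl⟩ : ∃ j, i = j + 1 := ⟨i - 1, by omega⟩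
      exact hmin.not_lt (c.start_lt h (by omega) (by omega))
    · obtain ⟨x, hx⟩ := not_isMin_iff.1 hmin
      obtain ⟨x, -, hx⟩ := exists_le_covBy_of_lt hx
      exact Or.inr ((h.left_le_of_covBy hc hx).trans_lt hx.lt)
  have hPR : PR ∧ IsMax (t (i + 1)) ∨ t (i + 1) < R (t (i + 1)) := by
    by_cases hmax : IsMax (t (i + 1))
    · refine Or.inl ⟨hcon.2 ?_, hmax⟩
      by_contra hne
      exact hmax.not_lt (c.lt (i + 1) (by omega) (by omega))
    · obtain ⟨x, hx⟩ := not_isMax_iff.1 hmax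
      obtain ⟨x, hx, -⟩ := exists_covBy_le_of_lt hx
      exact Or.inr (hx.lt.trans_le (h.le_right_of_covBy hc hx))
  obtain ⟨hLu, hRu⟩ := c.left_eq_and_right_eq h hT hi hi' he.ge le_rfl
  have hss := c.start_lt h hi hi'
  have htt := c.lt i hi hi'
  have hLt' := c.left (i + 1) (by omega) hi'
  have hRs := c.right i hi hi'.le
  obtain ⟨y, hy, hyt⟩ := exists_covBy_le_of_lt htt
  have hRy := c.right_of_covBy i hi hi' y hy
  obtain ⟨x, hsx, hx⟩ := exists_le_covBy_of_lt (show s i < t i by order)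
  have hxlt := hx.lt
  have hylt := hy.lt
  have hxy := hcut x (t i) y hx hy
  have hyRx : y ≤ R x := (h.adj_iff (by order)).1 hxy
  have hLyx : L y ≤ x := (h.adj_iff' (by order)).1 hxy
  have hsx' : s i < x := by
    refine hsx.lt_of_ne ?_
    rintro hex
    rw [← hex] at hyRx
    order
  have hLx : L x = s i := by
    have h1 := h.left_mono hx.le
    by_contra hne
    have hlt : L x < s i := by order
    have hi2 : 2 ≤ i := by
      by_contra hlt2
      obtain rfl : i = 1 := by omega
      exact c.isMin.not_lt hlt
    obtain ⟨x', hx', hxs'⟩ := exists_le_covBy_of_lt hlt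
    have h3 := hT i hi2 hi' x' y hxs' hy
    have h5 := (h.le_right_iff (show x' ≤ x by have := hxs'.lt; order)).2 hx'
    order
  have hRx : R x < t (i + 1) := by
    by_contra hle
    have := (h.le_right_iff (show x ≤ t (i + 1) by order)).1 (not_lt.1 hle)
    order
  have hLy : s i < L y := by
    by_contra hle
    have := (h.le_right_iff (show s i ≤ y by order)).2 (not_lt.1 hle)
    order
  have hyt' : y < t (i + 1) := by
    refine hyt.lt_of_ne ?_
    intro hey
    rw [← hey] at hLt'
    order
  have e1 := hA.iff_not h (u := s i) (w := t i) (by order) (by order)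
    (hPL.imp_right fun _ => by order) (Or.inr (by order))
  have e2 := hA.iff_not h (u := t i) (w := t (i + 1)) (by order) (by order) (Or.inr (by order))
    (hPR.imp_right fun _ => by order)
  have e3 := hA.iff_not h (u := y) (w := t (i + 1)) (by order) (by order) (Or.inr (by order))
    (hPR.imp_right fun _ => by order)
  have e4 := hA.iff_not h (u := x) (w := y) (by order) (by order) (Or.inr (by order))
    (Or.inr (by order))
  have e5 := hA.iff_not h (u := s i) (w := x) (by order) (by order)
    (hPL.imp_right fun _ => by order) (Or.inr (by order))
  tauto

end Block

/-! ### Colouring a block of one of the types -/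

section Parts

variable {V : Type*} [LinearOrder V] {G : SimpleGraph V}

/-- Let the order be cut after each vertex of `Z` into parts, which are cliques. If no vertex has
neighbours both in earlier and in later parts, and cutvertices at the ends have none outside their
own part, then the vertices with a neighbour in an earlier part, together with a cutvertex at the
beginning, form a colour class. -/
theorem exists_isMiddleColouring_of_breaks (Z : Set V) {PL PR : Prop}
    (h1 : ∀ u w, u < w → (∀ z ∈ Z, u ≤ z → ¬ z < w) → G.Adj u w)
    (h2 : ∀ x v y, G.Adj x v → G.Adj v y → ∀ z ∈ Z, x ≤ z → z < v →
      ∀ z' ∈ Z, v ≤ z' → ¬ z' < y)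
    (h3 : PL → ∀ u v, IsMin u → G.Adj u v → ∀ z ∈ Z, u ≤ z → ¬ z < v)
    (h4 : PR → ∀ v w, IsMax w → G.Adj v w → ∀ z ∈ Z, v ≤ z → ¬ z < w) :
    ∃ A, IsMiddleColouring G PL PR A := by
  refine ⟨fun v => (∃ x, G.Adj x v ∧ ∃ z ∈ Z, x ≤ z ∧ z < v) ∨ (PL ∧ IsMin v),
    fun u w huw hadj hx hy => ?_⟩
  by_cases hcr : ∃ z ∈ Z, u ≤ z ∧ z < w
  · -- `u` and `w` lie in different parts
    obtain ⟨z, hz, huz, hzw⟩ := hcr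
    refine iff_of_false ?_ (fun hn => hn (Or.inl ⟨u, hadj, z, hz, huz, hzw⟩))
    rintro (⟨x, hxu, z', hz', hxz, hzu⟩ | ⟨hp, hmin⟩)
    · exact h2 x u w hxu hadj z' hz' hxz hzu z hz huz hzw
    · exact h3 hp u w hmin hadj z hz huz hzw
  · push Not at hcr
    refine iff_of_true ?_ ?_
    · rcases hx with hx | ⟨x, hxu, hx1, hx2⟩
      · exact Or.inr hx
      · refine Or.inl ⟨x, hx1, ?_⟩
        by_contra! hno
        refine hx2 (h1 x w (hxu.trans huw) fun z hz hxz => ?_)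
        exact not_lt.2 (hcr z hz (hno z hz hxz))
    · rintro (⟨x, hxw, z, hz, hxz, hzw⟩ | ⟨-, hmin⟩)
      · rcases hy with ⟨hp, hmax⟩ | ⟨y, hwy, hy1, hy2⟩
        · exact h4 hp x w hmax hxw z hz hxz hzw
        · refine hy2 (h1 u y (huw.trans hwy) fun z' hz' huz hzy => ?_)
          exact h2 x w y hxw hy1 z hz hxz hzw z' hz' (hcr z' hz' huz) hzy
      · exact hmin.not_lt huw

/-- The parts are the cliques of the canonical covering. A vertex shared by two consecutive cliques
goes to the second one, unless these are the last two cliques and the end of the block is no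
cutvertex. -/
theorem IsGreedyCover.exists_isMiddleColouring [Finite V] {L R : V → V} {k : ℕ} {s t : ℕ → V}
    (c : IsGreedyCover L R k s t) (h : HasEnds G L R)
    (hk : 1 ≤ k) {PL PR : Prop}
    (hT : ∀ i, 2 ≤ i → i < k → ∀ x y, x ⋖ s i → t i ⋖ y → R x < L y)
    (hO : ∀ i, 1 ≤ i → i < k → t i ⋖ s (i + 1) ∨
      t i = s (i + 1) ∧ ((i = 1 ∧ ¬ PL) ∨ (i + 1 = k ∧ ¬ PR))) :
    ∃ A, IsMiddleColouring G PL PR A := by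
  -- `τ i` is the last vertex of the `i`-th part
  have hτ : ∀ i, ∃ z, 1 ≤ i → i < k → z ≤ t i ∧ (∀ v, z < v → s (i + 1) ≤ v) ∧
      (2 ≤ i ∨ PL → z = t i) ∧ (i + 1 < k ∨ PR → z < s (i + 1)) := by
    intro i
    by_cases hi : 1 ≤ i ∧ i < k
    · rcases hO i hi.1 hi.2 with h1 | ⟨h1, h2⟩
      · exact ⟨t i, fun _ _ => ⟨le_rfl, fun v hv => h1.ge_of_gt hv, fun _ => rfl,
          fun _ => h1.lt⟩⟩
      · by_cases h3 : i + 1 < k ∨ PR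
        · obtain ⟨z, -, hz⟩ := exists_le_covBy_of_lt (c.start_lt h hi.1 hi.2)
          refine ⟨z, fun _ _ => ⟨h1 ▸ hz.le, fun v hv => hz.ge_of_gt hv, fun h4 => ?_,
            fun _ => hz.lt⟩⟩
          exfalso
          rcases h2 with ⟨h5, h6⟩ | ⟨h5, h6⟩
          · rcases h4 with h4 | h4
            · omega
            · exact h6 h4
          · rcases h3 with h3 | h3
            · omega
            · exact h6 h3
        · exact ⟨t i, fun _ _ => ⟨le_rfl, fun v hv => h1 ▸ hv.le, fun _ => rfl,
            fun h4 => absurd h4 h3⟩⟩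
    · exact ⟨t 1, fun h1 h2 => absurd ⟨h1, h2⟩ hi⟩
  choose τ hτ using hτ
  have hmono : ∀ i j, 1 ≤ i → i ≤ j → j < k → τ i ≤ τ j := by
    intro i j hi hij
    induction j, hij using Nat.le_induction with
    | base => exact fun _ => le_rfl
    | succ j hij ih =>
      intro hj
      have h1 := (hτ j (by omega) (by omega)).1
      have h2 := (hτ (j + 1) (by omega) hj).2.2.1 (Or.inl (by omega))
      have h3 := c.lt j (by omega) (by omega)
      exact (ih (by omega)).trans (by order)
  -- each vertex `v` lies in a part `j`
  have hpart : ∀ v, ∃ j, 1 ≤ j ∧ j ≤ k ∧ (j < k → v ≤ τ j) ∧ s j ≤ v ∧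
      (∀ i, 1 ≤ i → i < j → τ i < v) := by
    intro v
    have hex : ∃ j, 1 ≤ j ∧ (j < k → v ≤ τ j) := ⟨k, hk, fun h => absurd h (lt_irrefl k)⟩
    classical
    have hspec := Nat.find_spec hex
    have hlt : ∀ i, 1 ≤ i → i < Nat.find hex → i < k ∧ τ i < v := by
      intro i hi hlt
      have := Nat.find_min hex hlt
      simp only [not_and, not_forall, not_le] at this
      obtain ⟨h1, h2⟩ := this hi
      exact ⟨h1, h2⟩
    generalize Nat.find hex = j at hspec hlt
    refine ⟨j, hspec.1, ?_, hspec.2, ?_, fun i hi hij => (hlt i hi hij).2⟩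
    · by_contra hjk
      exact lt_irrefl k (hlt k hk (by omega)).1
    · rcases Nat.eq_or_lt_of_le hspec.1 with he | hj
      · rw [← he]
        exact (le_total (s 1) v).elim id fun h => c.isMin h
      · obtain ⟨i, rfl⟩ : ∃ i, j = i + 1 := ⟨j - 1, by omega⟩
        obtain ⟨h1, h2⟩ := hlt i (by omega) (by omega)
        exact (hτ i (by omega) h1).2.1 v h2
  have hbound : ∀ j v, 1 ≤ j → j ≤ k → (j < k → v ≤ τ j) → v ≤ t j := by
    intro j v hj hjk hv
    rcases hjk.eq_or_lt with rfl | hlt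
    · exact (le_total v (t j)).elim id fun h => c.isMax h
    · exact (hv hlt).trans (hτ j hj hlt).1
  refine exists_isMiddleColouring_of_breaks {z | ∃ i, 1 ≤ i ∧ i < k ∧ z = τ i} ?_ ?_ ?_ ?_
  · intro u w huw hno
    obtain ⟨j, hj, hjk, huτ, hsu, -⟩ := hpart u
    have hw : w ≤ t j := hbound j w hj hjk fun hlt =>
      not_lt.1 (hno (τ j) ⟨j, hj, hlt, rfl⟩ (huτ hlt))
    rw [h.adj_iff huw]
    have h1 := h.right_mono hsu
    rw [c.right j hj hjk] at h1
    exact hw.trans h1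
  · rintro x v y hxv hvy _ ⟨i, hi, hik, rfl⟩ hxi hiv _ ⟨i', hi', hik', rfl⟩ hvi' hiy'
    obtain ⟨j, hj, hjk, hvτ, hsv, hlast⟩ := hpart v
    have hij : i < j := by
      by_contra hle
      have h1 := hmono j i hj (by omega) hik
      have h2 := hvτ (by omega)
      order
    have hji : j ≤ i' := by
      by_contra hlt
      exact (hlast i' hi' (by omega)).not_ge hvi'
    have hjk' : j < k := by omega
    obtain ⟨l, rfl⟩ : ∃ l, j = l + 1 := ⟨j - 1, by omega⟩
    have hl := (hτ l (by omega) (by omega)).2.2.2 (Or.inl hjk')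
    have hr := (hτ (l + 1) hj hjk').2.2.1 (Or.inl (by omega))
    have h3 := hmono i l hi (by omega) (by omega)
    have h4 := hmono (l + 1) i' hj hji hik'
    obtain ⟨x', hx', hxs⟩ := exists_le_covBy_of_lt (show x < s (l + 1) by order)
    obtain ⟨y', hy', hyt⟩ := exists_covBy_le_of_lt (show t (l + 1) < y by order)
    have h5 := hT (l + 1) (by omega) hjk' x' y' hxs hy'
    have h6 : v ≤ R x := (h.adj_iff (by order)).1 hxv
    have h7 : L y ≤ v := (h.adj_iff' (by order)).1 hvy
    have h8 := h.right_mono hx'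
    have h9 := h.left_mono hyt
    order
  · rintro hP u v hu huv _ ⟨i, hi, hik, rfl⟩ hui hiv
    have h1 : v ≤ R u := (h.adj_iff (by order)).1 huv
    have h2 : u ≤ s 1 := (le_total u (s 1)).elim id fun h => hu h
    have h3 := h.right_mono h2
    rw [c.right 1 le_rfl hk] at h3
    have h4 := (hτ 1 le_rfl (by omega)).2.2.1 (Or.inr hP)
    have h5 := hmono 1 i le_rfl hi hik
    order
  · rintro hP v w hw hvw _ ⟨i, hi, hik, rfl⟩ hvi hiw
    have h1 : L w ≤ v := (h.adj_iff' (by order)).1 hvw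
    have h2 : t k ≤ w := (le_total w (t k)).elim (fun h => hw h) id
    have h3 := h.left_mono h2
    rw [c.left k hk le_rfl] at h3
    obtain ⟨l, rfl⟩ : ∃ l, k = l + 1 := ⟨k - 1, by omega⟩
    have h4 := (hτ l (by omega) (by omega)).2.2.2 (Or.inr hP)
    have h5 := hmono i l hi (by omega) (by omega)
    order

end Parts

/-! ### The types of a block -/

/-- The common form of the conditions on a block, where `PL` and `PR` say whether its first and its
last vertex is a cutvertex of the whole graph. Consecutive cliques of the canonical covering are
disjoint, except that the first two, or the last two, may share a vertex if the block does not
begin, respectively end, with a cutvertex. -/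
def HasType {V : Type*} [LinearOrder V] (G : SimpleGraph V) (PL PR : Prop) : Prop :=
  cc G = 1 ∨ ∃ s t : ℕ → V, IsTyped G s t ∧ ∀ i, 1 ≤ i → i < cc G →
    t i ⋖ s (i + 1) ∨ t i = s (i + 1) ∧ ((i = 1 ∧ ¬ PL) ∨ (i + 1 = cc G ∧ ¬ PR))

section Types

variable {V : Type*} [LinearOrder V] {G : SimpleGraph V}

theorem IsTyped.two_le_cc {s t : ℕ → V} (h : IsTyped G s t) : 2 ≤ cc G := h.2.2.1

theorem IsType4.hasType {PL PR : Prop} : IsType4 G → HasType G PL PR := by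
  rintro ⟨s, t, h, h4⟩
  exact Or.inr ⟨s, t, h, fun i h1 h2 => Or.inl (h4 i h1 h2)⟩

theorem IsType2.hasType {PR : Prop} : IsType2 G → HasType G False PR := by
  rintro ⟨s, t, h, -, h1, h2⟩
  refine Or.inr ⟨s, t, h, fun i hi hi' => ?_⟩
  rcases hi.eq_or_lt with rfl | hlt
  · exact Or.inr ⟨h1, Or.inl ⟨rfl, not_false⟩⟩
  · exact Or.inl (h2 i hlt hi')

theorem IsType3.hasType {PL : Prop} : IsType3 G → HasType G PL False := by
  rintro ⟨s, t, h, -, h1, h2⟩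
  refine Or.inr ⟨s, t, h, fun i hi hi' => ?_⟩
  by_cases he : i + 1 = cc G
  · rw [← he, Nat.add_sub_cancel] at h1
    exact Or.inr ⟨h1, Or.inr ⟨he, not_false⟩⟩
  · exact Or.inl (h2 i hi (by omega))

theorem IsType1.hasType : IsType1 G → HasType G False False := by
  rintro ⟨s, t, h, h1, h2, h3⟩
  refine Or.inr ⟨s, t, h, fun i hi hi' => ?_⟩
  by_cases he : i + 1 = cc G
  · rw [← he, Nat.add_sub_cancel] at h2
    exact Or.inr ⟨h2, Or.inr ⟨he, not_false⟩⟩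
  · rcases hi.eq_or_lt with rfl | hlt
    · exact Or.inr ⟨h1, Or.inl ⟨rfl, not_false⟩⟩
    · exact Or.inl (h3 i hlt (by omega))

theorem IsType1.hasType_of_cc_eq_two {PL PR : Prop} (h2 : cc G = 2) (hP : ¬ PL ∨ ¬ PR) :
    IsType1 G → HasType G PL PR := by
  rintro ⟨s, t, h, h1, -, -⟩
  refine Or.inr ⟨s, t, h, fun i hi hi' => ?_⟩
  obtain rfl : i = 1 := by omega
  exact Or.inr ⟨h1, hP.imp (fun h => ⟨rfl, h⟩) (fun h => ⟨by omega, h⟩)⟩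

theorem hasType_true_true : HasType G True True ↔ cc G = 1 ∨ IsType4 G := by
  constructor
  · rintro (h | ⟨s, t, h, h1⟩)
    · exact Or.inl h
    · exact Or.inr ⟨s, t, h, fun i hi hi' => (h1 i hi hi').resolve_right (by tauto)⟩
  · rintro (h | h)
    · exact Or.inl h
    · exact h.hasType

theorem hasType_false_true : HasType G False True ↔
    cc G = 1 ∨ (cc G = 2 ∧ IsType1 G) ∨ IsType2 G ∨ IsType4 G := by
  constructor
  · rintro (h | ⟨s, t, h, h1⟩)
    · exact Or.inl h
    · refine Or.inr ?_
      have h2 := h.two_le_cc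
      have hcov : ∀ i, 2 ≤ i → i + 1 ≤ cc G → t i ⋖ s (i + 1) := fun i hi hi' =>
        (h1 i (by omega) hi').resolve_right (by rintro ⟨-, h3 | h3⟩ <;> [omega; exact h3.2 trivial])
      rcases h1 1 le_rfl h2 with h3 | ⟨h3, -⟩
      · refine Or.inr (Or.inr ⟨s, t, h, fun i hi hi' => ?_⟩)
        rcases hi.eq_or_lt with rfl | hlt
        · exact h3
        · exact hcov i hlt hi'
      · rcases h2.eq_or_lt with h4 | h4
        · refine Or.inl ⟨h4.symm, s, t, h, h3, ?_, fun i hi hi' => hcov i hi (by omega)⟩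
          rw [← h4]
          exact h3
        · exact Or.inr (Or.inl ⟨s, t, h, h4, h3, hcov⟩)
  · rintro (h | ⟨h2, h⟩ | h | h)
    · exact Or.inl h
    · exact h.hasType_of_cc_eq_two h2 (Or.inl not_false)
    · exact h.hasType
    · exact h.hasType

theorem hasType_true_false : HasType G True False ↔
    cc G = 1 ∨ (cc G = 2 ∧ IsType1 G) ∨ IsType3 G ∨ IsType4 G := by
  constructor
  · rintro (h | ⟨s, t, h, h1⟩)
    · exact Or.inl h
    · refine Or.inr ?_
      have h2 := h.two_le_cc
      obtain ⟨l, hl⟩ : ∃ l, cc G = l + 1 := ⟨cc G - 1, by omega⟩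
      have hcov : ∀ i, 1 ≤ i → i + 2 ≤ cc G → t i ⋖ s (i + 1) := fun i hi hi' =>
        (h1 i hi (by omega)).resolve_right
          (by rintro ⟨-, h3 | h3⟩ <;> [exact h3.2 trivial; omega])
      rcases h1 l (by omega) (by omega) with h3 | ⟨h3, -⟩
      · refine Or.inr (Or.inr ⟨s, t, h, fun i hi hi' => ?_⟩)
        by_cases he : i = l
        · rwa [he]
        · exact hcov i hi (by omega)
      · have h3' : t (cc G - 1) = s (cc G) := by rwa [hl, Nat.add_sub_cancel]
        rcases h2.eq_or_lt with h4 | h4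
        · refine Or.inl ⟨h4.symm, s, t, h, ?_, h3', fun i hi hi' => hcov i (by omega) hi'⟩
          rwa [← h4] at h3'
        · exact Or.inr (Or.inl ⟨s, t, h, h4, h3', hcov⟩)
  · rintro (h | ⟨h2, h⟩ | h | h)
    · exact Or.inl h
    · exact h.hasType_of_cc_eq_two h2 (Or.inr not_false)
    · exact h.hasType
    · exact h.hasType

theorem hasType_false_false : HasType G False False ↔
    cc G = 1 ∨ IsType1 G ∨ IsType2 G ∨ IsType3 G ∨ IsType4 G := by
  constructor
  · rintro (h | ⟨s, t, h, h1⟩)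
    · exact Or.inl h
    · refine Or.inr ?_
      have h2 := h.two_le_cc
      obtain ⟨l, hl⟩ : ∃ l, cc G = l + 1 := ⟨cc G - 1, by omega⟩
      have hcov : ∀ i, 2 ≤ i → i + 2 ≤ cc G → t i ⋖ s (i + 1) := fun i hi hi' =>
        (h1 i (by omega) (by omega)).resolve_right (by omega)
      have hlast : t (cc G - 1) = s (cc G) ↔ t l = s (l + 1) := by
        rw [hl, Nat.add_sub_cancel]
      rcases h1 1 le_rfl h2 with h3 | ⟨h3, -⟩ <;>
        rcases h1 l (by omega) (by omega) with h4 | ⟨h4, -⟩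
      · refine Or.inr (Or.inr (Or.inr ⟨s, t, h, fun i hi hi' => ?_⟩))
        rcases hi.eq_or_lt with rfl | hlt
        · exact h3
        · by_cases he : i = l
          · rwa [he]
          · exact hcov i hlt (by omega)
      · have h5 : 3 ≤ cc G := by
          by_contra hlt
          obtain rfl : l = 1 := by omega
          exact h3.lt.ne h4
        refine Or.inr (Or.inr (Or.inl ⟨s, t, h, h5, hlast.2 h4, fun i hi hi' => ?_⟩))
        rcases hi.eq_or_lt with rfl | hlt
        · exact h3
        · exact hcov i hlt hi'
      · have h5 : 3 ≤ cc G := by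
          by_contra hlt
          obtain rfl : l = 1 := by omega
          exact h4.lt.ne h3
        refine Or.inr (Or.inl ⟨s, t, h, h5, h3, fun i hi hi' => ?_⟩)
        by_cases he : i = l
        · rwa [he]
        · exact hcov i hi (by omega)
      · exact Or.inl ⟨s, t, h, h3, hlast.2 h4, hcov⟩
  · rintro (h | h | h | h | h)
    · exact Or.inl h
    · exact h.hasType
    · exact h.hasType
    · exact h.hasType
    · exact h.hasType

theorem HasEnds.isGreatest_iff {L R : V → V} (h : HasEnds G L R) {x a : V} :
    IsGreatest (closedNbhd G x) a ↔ a = R x := by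
  rw [h x]
  exact (isGreatest_Icc ((h.left_le x).trans (h.le_right x))).isGreatest_iff_eq.trans eq_comm

theorem HasEnds.isLeast_iff {L R : V → V} (h : HasEnds G L R) {x a : V} :
    IsLeast (closedNbhd G x) a ↔ a = L x := by
  rw [h x]
  exact (isLeast_Icc ((h.left_le x).trans (h.le_right x))).isLeast_iff_eq.trans eq_comm

variable [Finite V]

/-- A block has a colouring if and only if it has one of the types. Instead of being reduced, it is
only supposed to have no twins other than its first and last vertex. -/
theorem exists_isMiddleColouring_iff_hasType (hS : IsStraightOrdering G) (hc : G.Connected)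
    (hcv : ∀ v, ¬ IsCutvertex G v)
    (hred : ∀ u w : V, ¬ IsMin u → ¬ IsMax u → ¬ IsMin w → ¬ IsMax w →
      closedNbhd G u = closedNbhd G w → u = w) {PL PR : Prop} :
    (∃ A, IsMiddleColouring G PL PR A) ↔ HasType G PL PR := by
  obtain ⟨L, R, h⟩ := hS.exists_hasEnds
  have := hc.nonempty
  have hpos := cc_pos (G := G)
  have hcut : ∀ x v y : V, x ⋖ v → v ⋖ y → G.Adj x y := by
    intro x v y hx hy
    by_contra hn
    exact hcv v ((isCutvertex_iff h.isUmbrella hc).2 ⟨x, y, hx, hy, hn⟩)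
  constructor
  · rintro ⟨A, hA⟩
    rcases hpos.eq_or_lt with h1 | h2
    · exact Or.inl h1.symm
    · obtain ⟨s, t, hst⟩ := h.exists_isCanonicalCliqueCovering
      have c := h.isGreedyCover hst
      have hred' : ∀ u w : V, ¬ IsMin u → ¬ IsMax u → ¬ IsMin w → ¬ IsMax w → L u = L w →
          R u = R w → u = w := fun u w h1 h2 h3 h4 h5 h6 =>
        hred u w h1 h2 h3 h4 (h.closedNbhd_eq h5 h6)
      have hT := c.right_lt_left h hc hcut hred' hA
      refine Or.inr ⟨s, t, ⟨⟨three_le_card_of_two_le_cc hc h2, hc, hcv⟩, hS, h2, hst, ?_⟩, ?_⟩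
      · intro i hi hi' x y a b hx hy ha hb
        rw [h.isGreatest_iff.1 ha, h.isLeast_iff.1 hb]
        exact hT i hi hi' x y hx hy
      · intro i hi hi'
        refine (c.covBy_or_eq h hred' hT hi hi').imp_right fun he => ⟨he, ?_⟩
        exact c.end_of_eq h hc hcut hA hT hi hi' he
  · rintro (h1 | ⟨s, t, ⟨-, -, -, hst, hT⟩, hO⟩)
    · refine ⟨fun v => IsMin v, fun u w huw _ hu _ => ?_⟩
      refine iff_of_true ?_ (fun hn => hn.not_lt huw)
      rcases hu with hu | ⟨x, hxu, -, hx⟩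
      · exact hu.2
      · exact absurd (adj_of_cc_eq_one h1 (hxu.trans huw).ne) hx
    · have c := h.isGreedyCover hst
      refine c.exists_isMiddleColouring h hpos (fun i hi hi' x y hx hy => ?_) hO
      exact hT i hi hi' x y _ _ hx hy (h.isGreatest_iff.2 rfl) (h.isLeast_iff.2 rfl)

end Types

/-! ### Restriction to blocks and gluing at cutvertices -/

section Glue

variable {V : Type*} [LinearOrder V] {G : SimpleGraph V}

/-- The restriction of the condition `IsMiddleColouring G False False` to the pairs of vertices of
`S`. The induced paths in question may leave `S`. -/
def IsMiddleColouringOn (G : SimpleGraph V) (S : Set V) (A : V → Prop) : Prop :=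
  ∀ u ∈ S, ∀ w ∈ S, u < w → G.Adj u w → (∃ x < u, G.Adj x u ∧ ¬ G.Adj x w) →
    (∃ y > w, G.Adj w y ∧ ¬ G.Adj u y) → (A u ↔ ¬ A w)

theorem IsMiddleColouringOn.mono {S T : Set V} {A : V → Prop} (hA : IsMiddleColouringOn G T A)
    (h : S ⊆ T) : IsMiddleColouringOn G S A :=
  fun u hu w hw => hA u (h hu) w (h hw)

theorem isMiddleColouringOn_univ {A : V → Prop} :
    IsMiddleColouringOn G Set.univ A ↔ IsMiddleColouring G False False A := by
  simp [IsMiddleColouringOn, IsMiddleColouring]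

variable [Finite V]

theorem IsUmbrella.not_adj_of_isCutvertex (h : IsUmbrella G) (hc : G.Connected) {u v w : V}
    (hv : IsCutvertex G v) (huv : u < v) (hvw : v < w) : ¬ G.Adj u w := by
  obtain ⟨x, y, hx, hy, hn⟩ := (isCutvertex_iff h hc).1 hv
  exact fun hA => hn (h.adj_of_le (hx.le_of_lt huv) (hx.lt.trans hy.lt) (hy.ge_of_gt hvw) hA)

/-- Interchanging the two classes of `B` if necessary, one may assume that `A` and `B` agree at the
cutvertex `v`. -/
theorem IsUmbrella.exists_isMiddleColouringOn_union (h : IsUmbrella G) (hc : G.Connected) {v : V}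
    (hv : IsCutvertex G v) {T : Set V} (hvT : v ∈ T) {A B : V → Prop}
    (hA : IsMiddleColouringOn G (Set.Iic v) A) (hB : IsMiddleColouringOn G T B) :
    ∃ C, IsMiddleColouringOn G (Set.Iic v ∪ T) C := by
  classical
  refine ⟨fun z => if z ≤ v then A z else ((A v ↔ B v) ↔ B z), ?_⟩
  intro u hu w hw huw hadj hx hy
  have hmem : ∀ z, v < z → z ∈ Set.Iic v ∪ T → z ∈ T := fun z hz h =>
    h.resolve_left fun hle => hz.not_ge hle
  rcases le_or_gt w v with hwv | hwv
  · have huv : u ≤ v := huw.le.trans hwv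
    simp only [hwv, huv, if_true]
    exact hA u huv w hwv huw hadj hx hy
  · have hwT := hmem w hwv hw
    rcases lt_trichotomy u v with huv | rfl | huv
    · exact absurd hadj (h.not_adj_of_isCutvertex hc hv huv hwv)
    · simp only [le_rfl, if_true, hwv.not_ge, if_false]
      have := hB u hvT w hwT huw hadj hx hy
      tauto
    · have := hB u (hmem u huv hu) w hwT huw hadj hx hy
      simp only [huv.not_ge, hwv.not_ge, if_false]
      tauto

/-- Colourings of the interval `S` in terms of the induced subgraph, if only its first and last
vertex have neighbours outside or are cutvertices. -/
theorem exists_isMiddleColouringOn_iff_hasType (h : IsUmbrella G) (hc : G.Connected)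
    (hred : IsReduced G) {S : Set V} (hne : S.Nonempty) (hS : S.OrdConnected) {PL PR : Prop}
    (hmin : ∀ u ∈ S, ∀ x ∉ S, x < u → G.Adj x u → PL ∧ IsLeast S u)
    (hmax : ∀ w ∈ S, ∀ y ∉ S, w < y → G.Adj w y → PR ∧ IsGreatest S w)
    (hPL : PL → ∀ u, IsLeast S u → IsCutvertex G u)
    (hPR : PR → ∀ w, IsGreatest S w → IsCutvertex G w)
    (hint : ∀ v ∈ S, IsCutvertex G v → IsLeast S v ∨ IsGreatest S v) :
    (∃ A, IsMiddleColouringOn G S A) ↔ HasType (G.induce S) PL PR := by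
  have hleast : ∀ u : S, IsMin u ↔ IsLeast S u := fun u =>
    ⟨fun hu => ⟨u.2, fun x hx => (le_total (u : V) x).elim id fun h => hu (b := ⟨x, hx⟩) h⟩,
      fun hu x _ => hu.2 x.2⟩
  have hgreatest : ∀ u : S, IsMax u ↔ IsGreatest S u := fun u =>
    ⟨fun hu => ⟨u.2, fun x hx => (le_total x (u : V)).elim id fun h => hu (b := ⟨x, hx⟩) h⟩,
      fun hu x _ => hu.2 x.2⟩
  have hcov : ∀ x y : S, x ⋖ y → (x : V) ⋖ y := fun x y hxy =>
    ⟨hxy.lt, fun z h1 h2 => hxy.2 (c := ⟨z, hS.out x.2 y.2 ⟨h1.le, h2.le⟩⟩) h1 h2⟩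
  have hSu := h.induce S
  have hSc : (G.induce S).Connected := by
    have := hne.to_subtype
    exact ⟨preconnected_of_forall_covBy fun x y hxy => h.adj_of_covBy hc (hcov x y hxy)⟩
  rw [← exists_isMiddleColouring_iff_hasType hSu.isStraightOrdering hSc]
  · constructor
    · rintro ⟨A, hA⟩
      refine ⟨fun v => A v, fun u w huw hadj hx hy => hA u u.2 w w.2 huw hadj ?_ ?_⟩
      · rcases hx with ⟨hP, hu⟩ | ⟨x, hxu, hx1, hx2⟩
        · have hcu := hPL hP u ((hleast u).1 hu)
          obtain ⟨x, -, hx, -, -⟩ := (isCutvertex_iff h hc).1 hcu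
          exact ⟨x, hx.lt, h.adj_of_covBy hc hx, h.not_adj_of_isCutvertex hc hcu hx.lt huw⟩
        · exact ⟨x, hxu, hx1, hx2⟩
      · rcases hy with ⟨hP, hw⟩ | ⟨y, hyw, hy1, hy2⟩
        · have hcw := hPR hP w ((hgreatest w).1 hw)
          obtain ⟨-, y, -, hy, -⟩ := (isCutvertex_iff h hc).1 hcw
          exact ⟨y, hy.lt, h.adj_of_covBy hc hy, h.not_adj_of_isCutvertex hc hcw huw hy.lt⟩
        · exact ⟨y, hyw, hy1, hy2⟩
    · rintro ⟨A, hA⟩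
      refine ⟨fun v => ∃ hv : v ∈ S, A ⟨v, hv⟩, fun u hu w hw huw hadj hx hy => ?_⟩
      simp only [hu, hw, exists_true_left]
      obtain ⟨x, hxu, hx1, hx2⟩ := hx
      obtain ⟨y, hyw, hy1, hy2⟩ := hy
      refine hA ⟨u, hu⟩ ⟨w, hw⟩ huw hadj ?_ ?_
      · by_cases hxS : x ∈ S
        · exact Or.inr ⟨⟨x, hxS⟩, hxu, hx1, hx2⟩
        · exact Or.inl ((hmin u hu x hxS hxu hx1).imp_right (hleast ⟨u, hu⟩).2)
      · by_cases hyS : y ∈ S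
        · exact Or.inr ⟨⟨y, hyS⟩, hyw, hy1, hy2⟩
        · exact Or.inl ((hmax w hw y hyS hyw hy1).imp_right (hgreatest ⟨w, hw⟩).2)
  · intro v hv
    obtain ⟨x, y, hx, hy, hn⟩ := (isCutvertex_iff hSu hSc).1 hv
    have hcv := (isCutvertex_iff h hc).2 ⟨x, y, hcov _ _ hx, hcov _ _ hy, hn⟩
    rcases hint v v.2 hcv with hl | hg
    · exact ((hleast v).2 hl).not_lt hx.lt
    · exact ((hgreatest v).2 hg).not_lt hy.lt
  · -- inner vertices have the same neighbours in the whole graph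
    have hin : ∀ u : S, ¬ IsMin u → ¬ IsMax u → ∀ z, z ∈ closedNbhd G u ↔
        ∃ hz : z ∈ S, ⟨z, hz⟩ ∈ closedNbhd (G.induce S) u := by
      intro u hu1 hu2 z
      constructor
      · intro hz
        by_cases hzS : z ∈ S
        · exact ⟨hzS, hz.imp (fun he => Subtype.ext he) id⟩
        · rcases hz with rfl | hz
          · exact absurd u.2 hzS
          · have hz : G.Adj u z := hz
            rcases lt_or_gt_of_ne hz.ne with hlt | hlt
            · exact absurd ((hgreatest u).2 (hmax u u.2 z hzS hlt hz).2) hu2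
            · exact absurd ((hleast u).2 (hmin u u.2 z hzS hlt hz.symm).2) hu1
      · rintro ⟨hz, hz'⟩
        exact hz'.imp (fun he => congrArg Subtype.val he) id
    intro u w hu1 hu2 hw1 hw2 he
    refine Subtype.ext (hred u w (Set.ext fun z => ?_))
    rw [hin u hu1 hu2, hin w hw1 hw2, he]

theorem exists_isMiddleColouring_iff_forall_block (h : IsUmbrella G) (hc : G.Connected)
    {m : ℕ} {j : Fin (m + 1) → V} (hj : ∀ i, IsCutvertex G (j i)) (hmono : StrictMono j) :
    (∃ A, IsMiddleColouring G False False A) ↔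
      (∃ A, IsMiddleColouringOn G (Set.Iic (j 0)) A) ∧
      (∃ A, IsMiddleColouringOn G (Set.Ici (j (Fin.last m))) A) ∧
      ∀ i : Fin m, ∃ A, IsMiddleColouringOn G (Set.Icc (j i.castSucc) (j i.succ)) A := by
  simp only [← isMiddleColouringOn_univ]
  constructor
  · rintro ⟨A, hA⟩
    exact ⟨⟨A, hA.mono (Set.subset_univ _)⟩, ⟨A, hA.mono (Set.subset_univ _)⟩,
      fun i => ⟨A, hA.mono (Set.subset_univ _)⟩⟩
  · rintro ⟨h0, ⟨B, hB⟩, hI⟩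
    have key : ∀ i, ∃ A, IsMiddleColouringOn G (Set.Iic (j i)) A := by
      intro i
      induction i using Fin.induction with
      | zero => exact h0
      | succ i ih =>
        obtain ⟨A, hA⟩ := ih
        obtain ⟨B, hB⟩ := hI i
        have := h.exists_isMiddleColouringOn_union hc (hj i.castSucc)
          (Set.left_mem_Icc.2 (hmono i.castSucc_lt_succ).le) hA hB
        rwa [Set.Iic_union_Icc_eq_Iic (hmono i.castSucc_lt_succ).le] at this
    obtain ⟨A, hA⟩ := key (Fin.last m)
    have := h.exists_isMiddleColouringOn_union hc (hj _) Set.self_mem_Ici hA hB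
    rwa [Set.Iic_union_Ici] at this

end Glue

section Main

variable {V : Type*} [Finite V] [LinearOrder V] {G : SimpleGraph V}

/-- For a graph with cutvertices `j 0 < ⋯ < j m`, the blocks are the intervals between them. -/
theorem isLocallyComplete2EdgeColourable_iff_of_isCutvertex (h : IsUmbrella G) (hc : G.Connected)
    (hred : IsReduced G) {m : ℕ} {j : Fin (m + 1) → V} (hmono : StrictMono j)
    (hj : Set.range j = {v : V | IsCutvertex G v}) :
    IsLocallyComplete2EdgeColourable G ↔
      HasType (G.induce (Set.Iic (j 0))) False True ∧
      HasType (G.induce (Set.Ici (j (Fin.last m)))) True False ∧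
      ∀ i : Fin m, HasType (G.induce (Set.Icc (j i.castSucc) (j i.succ))) True True := by
  have hj' : ∀ i, IsCutvertex G (j i) := fun i => hj.subset ⟨i, rfl⟩
  have hex : ∀ v, IsCutvertex G v → ∃ i, j i = v := fun v hv => hj.superset hv
  rw [isLocallyComplete2EdgeColourable_iff h,
    exists_isMiddleColouring_iff_forall_block h hc hj' hmono]
  have hI0 := isLeast_Ici (a := j (Fin.last m))
  have hI1 := isGreatest_Iic (a := j 0)
  refine and_congr ?_ (and_congr ?_ (forall_congr' fun i => ?_))
  · refine exists_isMiddleColouringOn_iff_hasType h hc hred ⟨_, hI1.1⟩ Set.ordConnected_Iic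
      ?_ ?_ False.elim ?_ ?_
    · intro u hu x hx hxu
      exact absurd (hxu.le.trans hu) hx
    · intro w hw y hy _ hA
      rcases (Set.mem_Iic.1 hw).eq_or_lt with rfl | hlt
      · exact ⟨trivial, hI1⟩
      · exact absurd hA (h.not_adj_of_isCutvertex hc (hj' 0) hlt (not_le.1 hy))
    · intro _ w hw
      rw [hw.unique hI1]
      exact hj' 0
    · intro v hv hcv
      obtain ⟨i, rfl⟩ := hex v hcv
      rw [le_antisymm hv (hmono.monotone (Fin.zero_le i))]
      exact Or.inr hI1
  · refine exists_isMiddleColouringOn_iff_hasType h hc hred ⟨_, hI0.1⟩ Set.ordConnected_Ici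
      ?_ ?_ ?_ False.elim ?_
    · intro u hu x hx _ hA
      rcases (Set.mem_Ici.1 hu).eq_or_lt with rfl | hlt
      · exact ⟨trivial, hI0⟩
      · exact absurd hA (h.not_adj_of_isCutvertex hc (hj' _) (not_le.1 hx) hlt)
    · intro w hw y hy hwy
      exact absurd ((Set.mem_Ici.1 hw).trans hwy.le) hy
    · intro _ u hu
      rw [hu.unique hI0]
      exact hj' _
    · intro v hv hcv
      obtain ⟨i, rfl⟩ := hex v hcv
      rw [le_antisymm (hmono.monotone (Fin.le_last i)) hv]
      exact Or.inl hI0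
  · have hlt := hmono i.castSucc_lt_succ
    have hL := isLeast_Icc hlt.le
    have hG := isGreatest_Icc hlt.le
    refine exists_isMiddleColouringOn_iff_hasType h hc hred ⟨_, hL.1⟩ Set.ordConnected_Icc
      ?_ ?_ ?_ ?_ ?_
    · intro u hu x hx hxu hA
      rcases hu.1.eq_or_lt with rfl | hlt'
      · exact ⟨trivial, hL⟩
      · have hx' : x < j i.castSucc := by
          by_contra hle
          exact hx ⟨not_lt.1 hle, hxu.le.trans hu.2⟩
        exact absurd hA (h.not_adj_of_isCutvertex hc (hj' _) hx' hlt')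
    · intro w hw y hy hwy hA
      rcases hw.2.eq_or_lt with rfl | hlt'
      · exact ⟨trivial, hG⟩
      · have hy' : j i.succ < y := by
          by_contra hle
          exact hy ⟨hw.1.trans hwy.le, not_lt.1 hle⟩
        exact absurd hA (h.not_adj_of_isCutvertex hc (hj' _) hlt' hy')
    · intro _ u hu
      rw [hu.unique hL]
      exact hj' _
    · intro _ w hw
      rw [hw.unique hG]
      exact hj' _
    · rintro v ⟨hv1, hv2⟩ hcv
      obtain ⟨l, rfl⟩ := hex v hcv
      have h1 := hmono.le_iff_le.1 hv1
      have h2 := hmono.le_iff_le.1 hv2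
      have h3 : l = i.castSucc ∨ l = i.succ := by
        simp only [Fin.ext_iff, Fin.le_def, Fin.val_castSucc, Fin.val_succ] at h1 h2 ⊢
        omega
      rcases h3 with rfl | rfl
      · exact Or.inl hL
      · exact Or.inr hG

end Main

end LocComplete

/-- The straight ordering `v₁ < v₂ < ⋯ < vₙ` of `G` is the linear order on `V`. An induced subgraph
`G[i,j]` is `G.induce` of an interval, with the inherited order. In the second alternative the
cutvertices are `j 0 < j 1 < ⋯ < j m`; there is at least one of them. -/
theorem mainTheorem2 {V : Type*} [Finite V] [LinearOrder V] (G : SimpleGraph V)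
    (hconn : G.Connected) (hred : LocComplete.IsReduced G)
    (hpig : LocComplete.IsProperIntervalGraph G) (hord : LocComplete.IsStraightOrdering G) :
    LocComplete.IsLocallyComplete2EdgeColourable G ↔
      ((∀ v : V, ¬ LocComplete.IsCutvertex G v) ∧
        (LocComplete.cc G = 1 ∨ LocComplete.IsType1 G ∨ LocComplete.IsType2 G ∨
          LocComplete.IsType3 G ∨ LocComplete.IsType4 G)) ∨
      (∃ (m : ℕ) (j : Fin (m + 1) → V),
        StrictMono j ∧ Set.range j = {v : V | LocComplete.IsCutvertex G v} ∧
        ¬ IsMin (j 0) ∧ ¬ IsMax (j (Fin.last m)) ∧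
        (LocComplete.cc (G.induce (Set.Iic (j 0))) = 1 ∨
          (LocComplete.cc (G.induce (Set.Iic (j 0))) = 2 ∧
            LocComplete.IsType1 (G.induce (Set.Iic (j 0)))) ∨
          LocComplete.IsType2 (G.induce (Set.Iic (j 0))) ∨
          LocComplete.IsType4 (G.induce (Set.Iic (j 0)))) ∧
        (LocComplete.cc (G.induce (Set.Ici (j (Fin.last m)))) = 1 ∨
          (LocComplete.cc (G.induce (Set.Ici (j (Fin.last m)))) = 2 ∧
            LocComplete.IsType1 (G.induce (Set.Ici (j (Fin.last m))))) ∨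
          LocComplete.IsType3 (G.induce (Set.Ici (j (Fin.last m)))) ∨
          LocComplete.IsType4 (G.induce (Set.Ici (j (Fin.last m))))) ∧
        ∀ i : Fin m,
          LocComplete.cc (G.induce (Set.Icc (j i.castSucc) (j i.succ))) = 1 ∨
          LocComplete.IsType4 (G.induce (Set.Icc (j i.castSucc) (j i.succ)))) := by
  have h := hord.isUmbrella
  simp only [← LocComplete.hasType_false_false, ← LocComplete.hasType_false_true,
    ← LocComplete.hasType_true_false, ← LocComplete.hasType_true_true]
  by_cases hex : ∃ v, LocComplete.IsCutvertex G v
  · constructor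
    · intro hG
      right
      have hfin := Set.toFinite {v : V | LocComplete.IsCutvertex G v}
      obtain ⟨m, hm⟩ : ∃ m, hfin.toFinset.card = m + 1 := by
        obtain ⟨v, hv⟩ := hex
        have hpos := Finset.card_pos.2 ⟨v, hfin.mem_toFinset.2 hv⟩
        exact ⟨hfin.toFinset.card - 1, by omega⟩
      let j : Fin (m + 1) → V := hfin.toFinset.orderEmbOfFin hm
      have hmono : StrictMono j := (hfin.toFinset.orderEmbOfFin hm).strictMono
      have hj : Set.range j = {v : V | LocComplete.IsCutvertex G v} := by
        rw [Finset.range_orderEmbOfFin, hfin.coe_toFinset]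
      have hj' : ∀ i, LocComplete.IsCutvertex G (j i) := fun i => hj.subset ⟨i, rfl⟩
      refine ⟨m, j, hmono, hj, ?_, ?_,
        (LocComplete.isLocallyComplete2EdgeColourable_iff_of_isCutvertex
          h hconn hred hmono hj).1 hG⟩
      · obtain ⟨x, -, hx, -, -⟩ := (LocComplete.isCutvertex_iff h hconn).1 (hj' 0)
        exact not_isMin_iff.2 ⟨x, hx.lt⟩
      · obtain ⟨-, y, -, hy, -⟩ := (LocComplete.isCutvertex_iff h hconn).1 (hj' (Fin.last m))
        exact not_isMax_iff.2 ⟨y, hy.lt⟩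
    · rintro (⟨hno, -⟩ | ⟨m, j, hmono, hj, -, -, hG⟩)
      · obtain ⟨v, hv⟩ := hex
        exact absurd hv (hno v)
      · exact (LocComplete.isLocallyComplete2EdgeColourable_iff_of_isCutvertex
          h hconn hred hmono hj).2 hG
  · push Not at hex
    rw [LocComplete.isLocallyComplete2EdgeColourable_iff h,
      LocComplete.exists_isMiddleColouring_iff_hasType hord hconn hex
        fun u w _ _ _ _ he => hred u w he]
    constructor
    · exact fun hG => Or.inl ⟨hex, hG⟩
    · rintro (⟨-, hG⟩ | ⟨m, j, -, hj, -⟩)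
      · exact hG
      · have h0 : LocComplete.IsCutvertex G (j 0) := hj.subset ⟨0, rfl⟩
        exact absurd h0 (hex _)
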